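/- Let $\mathcal T$ be a triangulated category with countable direct sums. Let $\mathfrak I$ be a stable homological ideal in $\mathcal T$ (the class of morphisms killed by some stable homological functor to a stable abelian category) that is compatible with countable direct sums and has enough projective objects. Let $F\colon\mathcal T\to\mathcal A$ be the universal $\mathfrak I$-exact stable homological functor. Let $A\in\mathcal A$ have cohomological (that is, projective) dimension at most $2$. Let $(\hat A_1,\alpha_1)$ and $(\hat A_2,\alpha_2)$ be two liftings of $A$; that is, $\mathcal T(\hat A_i,B)=0$ for all $\mathfrak I$-contractible $B$, and $\alpha_i\colon F(\hat A_i)\cong A$ is an isomorphism. **Relative obstruction class.** Choose a projective resolution $0\to P_2\to P_1\to P_0\xrightarrow{\partial_0}A\to0$ and put $\Omega A=\ker\partial_0$. Let $\hat P_j=F^\vdash(P_j)$ be the canonical liftings of the $P_j$, where $F^\vdash$ is the partially defined left adjoint of $F$. Let $D$ be a lifting of $\Omega A$ with an exact triangle $\hat P_2\to\hat P_1\to D\to\hat P_2[1]$ that lifts $P_2\to P_1\to\Omega A$. Choose exact triangles $D\xrightarrow{\varphi_i}\hat P_0\to\hat A_i\to D[1]$, $i=1,2$, that lift the extension $\Omega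 A\to P_0\to A$. Then $F(\varphi_i-\varphi_j)=0$, and $\delta(\hat A_i,\hat A_j)\in\operatorname{Ext}^2(A,A[-1])$ is the image of $\varphi_i-\varphi_j$ under $$\ker\bigl(\mathcal T(D,\hat P_0)\to\operatorname{Hom}(\Omega A,P_0)\bigr)\cong\operatorname{Ext}^1(\Omega A,P_0[-1])\to\operatorname{Ext}^1(\Omega A,A[-1])\cong\operatorname{Ext}^2(A,A[-1]).$$ Here the first isomorphism comes from the triangle $\hat P_2\to\hat P_1\to D\to\hat P_2[1]$ (universal coefficient theorem), the middle map is induced by $\partial_0$, and the last isomorphism is the Yoneda product with the class of $\Omega A\to P_0\to A$. **ABC spectral sequence.** Let $N_{n+1}\xrightarrow{\varphi}P_n\xrightarrow{\pi}N_n\xrightarrow{\iota}N_{n+1}[1]$, $n\ge0$, be a phantom tower for $\hat A_1$: exact triangles with $N_0\cong\hat A_1$, with $\mathfrak I$-projective objects $P_n$ of $\mathcal T$, and with $\iota\in\mathfrak I$. Applying $\mathcal T(-,\hat A_2)$ to it gives an exact couple with $E_1^{p,q}=\mathcal T(P_p,\hat A_2[q])$, whose spectral sequence is the ABC spectral sequence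 for $\mathcal T(\hat A_1,\hat A_2)$. On its second page, a cocycle in $E_1^{p,q}$ is sent to the push-out along it of the Yoneda extension $F(N_p)\to F(P_{p-1})\to\dots\to F(P_0)\to F(N_0)\cong A$; this is a map $E_2^{p,q}\to\operatorname{Ext}^p(A,A[q])$. **Lemma.** Both kinds of choices exist. The classes $\delta(\hat A_1,\hat A_2)$ and $\delta(\hat A_2,\hat A_1)$ do not depend on the choices. For every phantom tower for $\hat A_1$, the maps $E_2^{0,0}\to\operatorname{Hom}(A,A)$ and $E_2^{2,-1}\to\operatorname{Ext}^2(A,A[-1])$ are isomorphisms. Under these identifications, the differential $d_2^{0,0}\colon E_2^{0,0}\to E_2^{2,-1}$ satisfies $$d_2^{0,0}(\mathrm{id}_A)=\delta(\hat A_1,\hat A_2)=-\delta(\hat A_2,\hat A_1).$$ -/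

import Mathlib

open CategoryTheory CategoryTheory.Limits CategoryTheory.Pretriangulated CategoryTheory.Abelian

universe w v₁ v₂ u₁ u₂ v u

namespace HomologicalIdeals

noncomputable section

section Ideals

variable {𝒯 : Type u₁} [Category.{v₁} 𝒯] [HasZeroObject 𝒯] [HasShift 𝒯 ℤ] [Preadditive 𝒯]
  [∀ n : ℤ, (shiftFunctor 𝒯 n).Additive] [Pretriangulated 𝒯]

/-- A functor annihilates (all morphisms in) `I`.  A homological functor with this property is
called `I`-exact. -/
def Annihilates {𝓑 : Type u} [Category.{v} 𝓑] [HasZeroMorphisms 𝓑]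
    (I : MorphismProperty 𝒯) (G : 𝒯 ⥤ 𝓑) : Prop :=
  ∀ ⦃X Y : 𝒯⦄ (f : X ⟶ Y), I f → G.map f = 0

/-- A stable homological ideal: the class of morphisms killed by some stable homological functor
to a stable abelian category (an abelian category with a shift by `ℤ`). -/
def IsStableHomologicalIdeal (I : MorphismProperty 𝒯) : Prop :=
  ∃ (𝓑 : Type u) (_ : Category.{v} 𝓑) (_ : Abelian 𝓑) (_ : HasShift 𝓑 ℤ)
    (_ : ∀ n : ℤ, (shiftFunctor 𝓑 n).Additive)
    (G : 𝒯 ⥤ 𝓑) (_ : G.CommShift ℤ) (_ : G.IsHomological),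
    ∀ ⦃X Y : 𝒯⦄ (f : X ⟶ Y), I f ↔ G.map f = 0

/-- Compatibility of `I` with countable direct sums: a morphism out of a countable direct sum
whose components all belong to `I` belongs to `I`. -/
def CompatibleWithCountableSums [HasCountableCoproducts 𝒯] (I : MorphismProperty 𝒯) : Prop :=
  ∀ (X : ℕ → 𝒯) (Y : 𝒯) (f : ∀ n, X n ⟶ Y), (∀ n, I (f n)) → I (Sigma.desc f)

/-- `P` is `I`-projective: the functor `𝒯(P, -)` annihilates `I`. -/
def IsProjectiveFor (I : MorphismProperty 𝒯) (P : 𝒯) : Prop :=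
  ∀ ⦃X Y : 𝒯⦄ (f : X ⟶ Y), I f → ∀ g : P ⟶ X, g ≫ f = 0

/-- `f : X ⟶ Y` is `I`-epic: in an exact triangle `X ⟶ Y ⟶ Z ⟶ X⟦1⟧` extending it, the
morphism `Y ⟶ Z` belongs to `I`. -/
def IsEpicFor (I : MorphismProperty 𝒯) {X Y : 𝒯} (f : X ⟶ Y) : Prop :=
  ∃ (Z : 𝒯) (g : Y ⟶ Z) (h : Z ⟶ X⟦(1 : ℤ)⟧), Triangle.mk f g h ∈ distTriang 𝒯 ∧ I g

/-- `I` has enough projective objects. -/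
def HasEnoughProjectives (I : MorphismProperty 𝒯) : Prop :=
  ∀ X : 𝒯, ∃ (P : 𝒯) (f : P ⟶ X), IsProjectiveFor I P ∧ IsEpicFor I f

/-- `B` is `I`-contractible. -/
def IsContractibleFor (I : MorphismProperty 𝒯) (B : 𝒯) : Prop := I (𝟙 B)

variable {𝒜 : Type u₂} [Category.{v₂} 𝒜] [Abelian 𝒜]

lemma map_comp_eq_zero (F : 𝒯 ⥤ 𝒜) [F.IsHomological] {X Y Z : 𝒯}
    {f : X ⟶ Y} {g : Y ⟶ Z} {h : Z ⟶ X⟦(1 : ℤ)⟧} (hT : Triangle.mk f g h ∈ distTriang 𝒯) :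
    F.map f ≫ F.map g = 0 := by
  have h₁ : f ≫ g = 0 := comp_distTriang_mor_zero₁₂ _ hT
  rw [← F.map_comp, h₁, F.map_zero]

variable [HasShift 𝒜 ℤ]

/-- `F` is the universal `I`-exact stable homological functor: it is `I`-exact, and every
`I`-exact stable homological functor to a stable abelian category factors through `F` by a stable
exact functor, which is unique up to isomorphism. -/
structure IsUniversalExact (I : MorphismProperty 𝒯) (F : 𝒯 ⥤ 𝒜) [F.CommShift ℤ]
    [F.IsHomological] : Prop where
  annihilates : Annihilates I F
  exists_factorization :
    ∀ (𝓑 : Type u) [Category.{v} 𝓑] [Abelian 𝓑] [HasShift 𝓑 ℤ]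
      [∀ n : ℤ, (shiftFunctor 𝓑 n).Additive]
      (G : 𝒯 ⥤ 𝓑) [G.CommShift ℤ] [G.IsHomological], Annihilates I G →
      ∃ (H : 𝒜 ⥤ 𝓑) (_ : H.CommShift ℤ) (_ : PreservesFiniteLimits H)
        (_ : PreservesFiniteColimits H) (e : F ⋙ H ≅ G), NatTrans.CommShift e.hom ℤ
  unique_factorization :
    ∀ (𝓑 : Type u) [Category.{v} 𝓑] [Abelian 𝓑] [HasShift 𝓑 ℤ]
      [∀ n : ℤ, (shiftFunctor 𝓑 n).Additive]
      (H H' : 𝒜 ⥤ 𝓑) [H.CommShift ℤ] [H'.CommShift ℤ]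
      [PreservesFiniteLimits H] [PreservesFiniteColimits H]
      [PreservesFiniteLimits H'] [PreservesFiniteColimits H']
      (e : F ⋙ H ≅ F ⋙ H'), NatTrans.CommShift e.hom ℤ →
      Nonempty (H ≅ H')

/-- A lifting of an object `A` of `𝒜`: an object `obj` of `𝒯` with `𝒯(obj, B) = 0` for all
`I`-contractible `B`, together with an isomorphism `F(obj) ≅ A`. -/
structure Lifting (I : MorphismProperty 𝒯) (F : 𝒯 ⥤ 𝒜) (A : 𝒜) where
  obj : 𝒯
  orthogonal : ∀ (B : 𝒯), IsContractibleFor I B → ∀ f : obj ⟶ B, f = 0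
  iso : F.obj obj ≅ A

/-- The value `obj = F^⊢(P)` at `P` of the partially defined left adjoint `F^⊢` of `F`, with
`F(F^⊢(P)) ≅ P` through the unit of the adjunction. -/
structure AdjointLift (F : 𝒯 ⥤ 𝒜) (P : 𝒜) where
  obj : 𝒯
  iso : F.obj obj ≅ P
  bijective : ∀ B : 𝒯, Function.Bijective fun f : obj ⟶ B => iso.inv ≫ F.map f

/-- If `F` kills the last morphism of an exact triangle, the other two become a short exact
sequence. -/
lemma shortExact_of_triangle (F : 𝒯 ⥤ 𝒜) [F.CommShift ℤ] [F.IsHomological] {X Y Z : 𝒯}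
    {f : X ⟶ Y} {g : Y ⟶ Z} {h : Z ⟶ X⟦(1 : ℤ)⟧} (hT : Triangle.mk f g h ∈ distTriang 𝒯)
    (hF : F.map h = 0) :
    (ShortComplex.mk (F.map f) (F.map g) (map_comp_eq_zero F hT)).ShortExact := by
  have hF' : F.map (h⟦(-1 : ℤ)⟧') = 0 := by
    have h₁ := (F.commShiftIso (-1 : ℤ)).hom.naturality h
    rw [← cancel_mono ((F.commShiftIso (-1 : ℤ)).hom.app _)]
    refine h₁.trans ?_
    change _ ≫ (shiftFunctor 𝒜 (-1 : ℤ)).map (F.map h) = _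
    rw [hF, zero_comp, Functor.map_zero, comp_zero]
  have ex₂ := F.map_distinguished_exact _ hT
  have ex₃ := F.map_distinguished_exact _ (rot_of_distTriang _ hT)
  have ex₁ := F.map_distinguished_exact _ (inv_rot_of_distTriang _ hT)
  have key : ∀ {W : 𝒯} (k : X⟦(1 : ℤ)⟧⟦(-1 : ℤ)⟧ ⟶ W), F.map (-(h⟦(-1 : ℤ)⟧' ≫ k)) = 0 := by
    intro W k
    rw [F.map_neg, F.map_comp, hF', zero_comp, neg_zero]
  have hm : Mono (F.map f) := ex₁.mono_g (key _)
  have he : Epi (F.map g) := ex₃.epi_f hF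
  exact { exact := ex₂, mono_f := hm, epi_g := he }

/-- In an exact triangle, a degree `q` map out of the third object that vanishes on the second one
factors through the third morphism. -/
lemma exists_eq_shiftedHom_comp {X Y Z B : 𝒯} {f : X ⟶ Y} {g : Y ⟶ Z}
    {h : ShiftedHom Z X (1 : ℤ)} (hT : Triangle.mk f g h ∈ distTriang 𝒯) {q' q : ℤ}
    (hq : q' + 1 = q) (z : ShiftedHom Z B q) (hz : g ≫ z = 0) :
    ∃ y : ShiftedHom X B q', h.comp y hq = z := by
  obtain ⟨t, ht⟩ : ∃ t : X⟦(1 : ℤ)⟧ ⟶ B⟦q⟧, z = h ≫ t := Triangle.yoneda_exact₃ _ hT z hz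
  obtain ⟨y, hy⟩ : ∃ y : X ⟶ B⟦q'⟧, y⟦(1 : ℤ)⟧' = t ≫ (shiftFunctorAdd' 𝒯 q' 1 q hq).hom.app B :=
    (shiftFunctor 𝒯 (1 : ℤ)).map_surjective _
  refine ⟨y, ?_⟩
  change h ≫ y⟦(1 : ℤ)⟧' ≫ _ = z
  rw [hy, Category.assoc, Iso.hom_inv_id_app, Category.comp_id, ht]

/-- In an exact triangle, a map of degree `q'` out of the first object that is killed by the third
morphism extends to the second object. -/
lemma exists_comp_eq_of_shiftedHom_comp_eq_zero {X Y Z B : 𝒯} {f : X ⟶ Y} {g : Y ⟶ Z}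
    {h : ShiftedHom Z X (1 : ℤ)} (hT : Triangle.mk f g h ∈ distTriang 𝒯) {q' q : ℤ}
    (hq : q' + 1 = q) (y : ShiftedHom X B q') (hy : h.comp y hq = 0) :
    ∃ z : ShiftedHom Y B q', f ≫ z = y := by
  have h₁ : h ≫ y⟦(1 : ℤ)⟧' = 0 := by
    rw [← cancel_mono ((shiftFunctorAdd' 𝒯 q' 1 q hq).inv.app B), Category.assoc, zero_comp]
    exact hy
  obtain ⟨z, hz⟩ : ∃ z : Y⟦(1 : ℤ)⟧ ⟶ B⟦q'⟧⟦(1 : ℤ)⟧, y⟦(1 : ℤ)⟧' = (-f⟦(1 : ℤ)⟧') ≫ z :=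
    Triangle.yoneda_exact₃ _ (rot_of_distTriang _ hT) _ h₁
  obtain ⟨z', rfl⟩ := (shiftFunctor 𝒯 (1 : ℤ)).map_surjective z
  refine ⟨-z', (shiftFunctor 𝒯 (1 : ℤ)).map_injective ?_⟩
  rw [hz]
  simp

end Ideals

section Towers

variable {𝒯 : Type u₁} [Category.{v₁} 𝒯] [HasZeroObject 𝒯] [HasShift 𝒯 ℤ] [Preadditive 𝒯]
  [∀ n : ℤ, (shiftFunctor 𝒯 n).Additive] [Pretriangulated 𝒯]

/-- A phantom tower over `X`: objects `N₀ ≅ X, N₁, N₂, …`, `I`-projective objects `P₀, P₁, …` and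
exact triangles `N (n+1) ⟶ P n ⟶ N n ⟶ (N (n+1))⟦1⟧` whose last morphism belongs to `I`. -/
structure PhantomTower (I : MorphismProperty 𝒯) (X : 𝒯) where
  N : ℕ → 𝒯
  P : ℕ → 𝒯
  φ (n : ℕ) : N (n + 1) ⟶ P n
  π (n : ℕ) : P n ⟶ N n
  ι (n : ℕ) : ShiftedHom (N n) (N (n + 1)) (1 : ℤ)
  base : N 0 ≅ X
  projective (n : ℕ) : IsProjectiveFor I (P n)
  distinguished (n : ℕ) : Triangle.mk (φ n) (π n) (ι n) ∈ distTriang 𝒯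
  phantom (n : ℕ) : I (ι n)

namespace PhantomTower

variable {I : MorphismProperty 𝒯} {X : 𝒯} (t : PhantomTower I X) (B : 𝒯)

/-! The ABC spectral sequence is the one of the exact couple obtained by applying the
cohomological functor `𝒯(-, B)` to a phantom tower, with
`D^{p,q} = 𝒯(N p, B⟦q⟧)` and `E₁^{p,q} = 𝒯(P p, B⟦q⟧)`. -/

/-- The map `D^{p+1,q'} → D^{p,q}` of the exact couple (`q' + 1 = q`), induced by `ι p`. -/
def coupleI (p : ℕ) {q' q : ℤ} (h : q' + 1 = q) :
    ShiftedHom (t.N (p + 1)) B q' →+ ShiftedHom (t.N p) B q :=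
  AddMonoidHom.mk' (fun y => (t.ι p).comp y h) fun y y' => ShiftedHom.comp_add _ y y' h

/-- The map `D^{p,q} → E₁^{p,q}` of the exact couple, induced by `π p`. -/
def coupleJ (p : ℕ) (q : ℤ) : ShiftedHom (t.N p) B q →+ ShiftedHom (t.P p) B q :=
  AddMonoidHom.mk' (fun y => t.π p ≫ y) fun _ _ => Preadditive.comp_add _ _ _ _ _ _

/-- The map `E₁^{p,q} → D^{p+1,q}` of the exact couple, induced by `φ p`. -/
def coupleK (p : ℕ) (q : ℤ) : ShiftedHom (t.P p) B q →+ ShiftedHom (t.N (p + 1)) B q :=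
  AddMonoidHom.mk' (fun x => t.φ p ≫ x) fun _ _ => Preadditive.comp_add _ _ _ _ _ _

/-- The differential `d₁ : E₁^{p,q} → E₁^{p+1,q}`. -/
def d₁ (p : ℕ) (q : ℤ) : ShiftedHom (t.P p) B q →+ ShiftedHom (t.P (p + 1)) B q :=
  (t.coupleJ B (p + 1) q).comp (t.coupleK B p q)

/-- The cycles of `d₁`. -/
def cycles (p : ℕ) (q : ℤ) : AddSubgroup (ShiftedHom (t.P p) B q) := (t.d₁ B p q).ker

/-- The boundaries of `d₁`. -/
def boundaries : ∀ (p : ℕ) (q : ℤ), AddSubgroup (ShiftedHom (t.P p) B q)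
  | 0, _ => ⊥
  | p + 1, q => (t.d₁ B p q).range

/-- The second page `E₂^{p,q} = ker d₁ / im d₁`. -/
abbrev E₂ (p : ℕ) (q : ℤ) : Type v₁ :=
  t.cycles B p q ⧸ (t.boundaries B p q).addSubgroupOf (t.cycles B p q)

variable {B}

lemma coupleK_coupleJ (p : ℕ) (q : ℤ) (y : ShiftedHom (t.N p) B q) :
    t.coupleK B p q (t.coupleJ B p q y) = 0 := by
  have h : t.φ p ≫ t.π p = 0 := comp_distTriang_mor_zero₁₂ _ (t.distinguished p)
  change t.φ p ≫ t.π p ≫ y = 0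
  rw [← Category.assoc, h, zero_comp]

lemma coupleJ_mem_cycles (p : ℕ) (q : ℤ) (y : ShiftedHom (t.N p) B q) :
    t.coupleJ B p q y ∈ t.cycles B p q := by
  change t.coupleJ B (p + 1) q (t.coupleK B p q (t.coupleJ B p q y)) = 0
  rw [coupleK_coupleJ, map_zero]

/-- The class in `E₂^{p,q}` of `j y`. -/
def mkJ (p : ℕ) (q : ℤ) : ShiftedHom (t.N p) B q →+ t.E₂ B p q :=
  (QuotientAddGroup.mk' _).comp
    ((t.coupleJ B p q).codRestrict (t.cycles B p q) (t.coupleJ_mem_cycles p q))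

/-- Exactness at `D^{p,q}`: the kernel of `j` is contained in the image of `i`. -/
lemma exists_coupleI_eq {p : ℕ} {q' q : ℤ} (h : q' + 1 = q) (x : t.cycles B p q) :
    ∃ y : ShiftedHom (t.N (p + 2)) B q', t.coupleI B (p + 1) h y = t.coupleK B p q x :=
  exists_eq_shiftedHom_comp (t.distinguished (p + 1)) h _ x.2

/-- Exactness at `D^{p+1,q'}`: the kernel of `i` is contained in the image of `k`. -/
lemma mkJ_eq_zero {p : ℕ} {q' q : ℤ} (h : q' + 1 = q) (y : ShiftedHom (t.N (p + 1)) B q')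
    (hy : t.coupleI B p h y = 0) : t.mkJ (p + 1) q' y = 0 := by
  obtain ⟨z, hz⟩ : ∃ z : ShiftedHom (t.P p) B q', t.coupleK B p q' z = y :=
    exists_comp_eq_of_shiftedHom_comp_eq_zero (t.distinguished p) h y hy
  refine (QuotientAddGroup.eq_zero_iff _).2 ?_
  exact ⟨z, congrArg (t.coupleJ B (p + 1) q') hz⟩

/-- The differential `d₂ : E₂^{p,q} → E₂^{p+2,q'}`, `q' = q - 1`, of the derived couple:
`d₂[x] = [j y]` for any `y ∈ D^{p+2,q'}` with `i y = k x`. -/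
def d₂ (p : ℕ) {q' q : ℤ} (h : q' + 1 = q) : t.E₂ B p q →+ t.E₂ B (p + 2) q' :=
  QuotientAddGroup.lift _
    (AddMonoidHom.mk' (fun x => t.mkJ (p + 2) q' (t.exists_coupleI_eq h x).choose) (by
      intro x x'
      rw [← map_add, ← sub_eq_zero, ← map_sub]
      refine t.mkJ_eq_zero h _ ?_
      rw [map_sub, map_add, (t.exists_coupleI_eq h x).choose_spec,
        (t.exists_coupleI_eq h x').choose_spec, (t.exists_coupleI_eq h (x + x')).choose_spec,
        ← map_add, ← map_sub]
      simp))
    (by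
      intro x hx
      refine t.mkJ_eq_zero h _ ?_
      rw [(t.exists_coupleI_eq h x).choose_spec]
      cases p with
      | zero =>
        have hx' : (x : ShiftedHom (t.P 0) B q) = 0 := hx
        rw [hx', map_zero]
      | succ p =>
        obtain ⟨z, hz⟩ := hx
        have hz' : t.coupleJ B (p + 1) q (t.coupleK B p q z) = x := hz
        rw [← hz', coupleK_coupleJ])

/-- `d₂[x] = [j y]` whenever `i y = k x`. -/
lemma d₂_mk {p : ℕ} {q' q : ℤ} (h : q' + 1 = q) (x : t.cycles B p q)
    (y : ShiftedHom (t.N (p + 2)) B q') (hy : t.coupleI B (p + 1) h y = t.coupleK B p q x) :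
    t.d₂ p h (QuotientAddGroup.mk x) = t.mkJ (p + 2) q' y := by
  change t.mkJ (p + 2) q' (t.exists_coupleI_eq h x).choose = _
  rw [← sub_eq_zero, ← map_sub]
  refine t.mkJ_eq_zero h _ ?_
  rw [map_sub, (t.exists_coupleI_eq h x).choose_spec, hy, sub_self]

section Comparison

variable {𝒜 : Type u₂} [Category.{v₂} 𝒜] [Abelian 𝒜] [HasShift 𝒜 ℤ]
  {F : 𝒯 ⥤ 𝒜} [F.CommShift ℤ] [F.IsHomological]

/-- The short exact sequence `F(N (n+1)) ⟶ F(P n) ⟶ F(N n)`. -/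
lemma shortExact (hF : Annihilates I F) (n : ℕ) :
    (ShortComplex.mk (F.map (t.φ n)) (F.map (t.π n))
      (map_comp_eq_zero F (t.distinguished n))).ShortExact :=
  shortExact_of_triangle F (t.distinguished n) (hF _ (t.phantom n))

lemma map_comp_eq_zero_of_mem_cycles (hF : Annihilates I F) {p : ℕ} {q : ℤ} (x : t.cycles B p q) :
    F.map (t.φ p) ≫ ShiftedHom.map (x : ShiftedHom (t.P p) B q) F = 0 := by
  have h₁ := (t.shortExact hF (p + 1)).epi_g
  dsimp only at h₁
  have h₂ : t.π (p + 1) ≫ t.φ p ≫ (x : ShiftedHom (t.P p) B q) = 0 := x.2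
  rw [← cancel_epi (F.map (t.π (p + 1))), comp_zero, ShiftedHom.map, ← Category.assoc,
    ← Category.assoc, ← F.map_comp, ← F.map_comp, Category.assoc, h₂, F.map_zero, zero_comp]

variable (hF : Annihilates I F)

/-- For a cycle `x ∈ 𝒯(P p, B⟦q⟧)`, the morphism `F(N p) ⟶ F(B)⟦q⟧` through which
`F(x) : F(P p) ⟶ F(B)⟦q⟧` factors. -/
def descCycle (p : ℕ) (q : ℤ) (x : t.cycles B p q) : F.obj (t.N p) ⟶ (F.obj B)⟦q⟧ :=
  have := (t.shortExact hF p).epi_g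
  (t.shortExact hF p).exact.desc (ShiftedHom.map (x : ShiftedHom (t.P p) B q) F)
    (t.map_comp_eq_zero_of_mem_cycles hF x)

lemma map_comp_descCycle (p : ℕ) (q : ℤ) (x : t.cycles B p q) :
    F.map (t.π p) ≫ t.descCycle hF p q x = ShiftedHom.map (x : ShiftedHom (t.P p) B q) F :=
  have := (t.shortExact hF p).epi_g
  (t.shortExact hF p).exact.g_desc _ _

variable [HasExt.{w} 𝒜]

/-- The class in `Ext^p(F(N 0), F(N p))` of the Yoneda extension
`F(N p) ⟶ F(P (p-1)) ⟶ ⋯ ⟶ F(P 0) ⟶ F(N 0)`. -/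
def yonedaClass : ∀ p : ℕ, Ext.{w} (F.obj (t.N 0)) (F.obj (t.N p)) p
  | 0 => Ext.mk₀ (𝟙 _)
  | p + 1 => (yonedaClass p).comp (t.shortExact hF p).extClass rfl

/-- The comparison map `E₂^{p,q} → Ext^p(F(N 0), F(B)⟦q⟧)`: a class `[x]` is sent to the
push-out along `F(x)` of the class of the extension
`F(N p) ⟶ F(P (p-1)) ⟶ ⋯ ⟶ F(P 0) ⟶ F(N 0)`. -/
def toExt (p : ℕ) (q : ℤ) : t.E₂ B p q →+ Ext.{w} (F.obj (t.N 0)) ((F.obj B)⟦q⟧) p :=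
  QuotientAddGroup.lift _
    (AddMonoidHom.mk' (fun x =>
      (t.yonedaClass hF p).comp (Ext.mk₀ (t.descCycle hF p q x)) (add_zero p)) (by
      intro x x'
      rw [← Ext.comp_add, ← Ext.mk₀_add]
      congr 2
      have := (t.shortExact hF p).epi_g
      dsimp only at this
      rw [← cancel_epi (F.map (t.π p)), Preadditive.comp_add]
      simp only [map_comp_descCycle]
      exact ShiftedHom.map_add _ _ F))
    (by
      intro x hx
      change (t.yonedaClass hF p).comp (Ext.mk₀ (t.descCycle hF p q x)) (add_zero p) = 0
      cases p with
      | zero =>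
        have hx' : (x : ShiftedHom (t.P 0) B q) = 0 := hx
        have h₀ : t.descCycle hF 0 q x = 0 := by
          have := (t.shortExact hF 0).epi_g
          dsimp only at this
          rw [← cancel_epi (F.map (t.π 0)), map_comp_descCycle, hx', ShiftedHom.map_zero,
            comp_zero]
        rw [h₀, Ext.mk₀_zero, Ext.comp_zero]
      | succ p =>
        obtain ⟨z, hz⟩ := hx
        have hz' : t.π (p + 1) ≫ t.φ p ≫ z = (x : ShiftedHom (t.P (p + 1)) B q) := hz
        have h₀ : t.descCycle hF (p + 1) q x = F.map (t.φ p) ≫ ShiftedHom.map z F := by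
          have := (t.shortExact hF (p + 1)).epi_g
          dsimp only at this
          rw [← cancel_epi (F.map (t.π (p + 1))), map_comp_descCycle, ← hz', ShiftedHom.map,
            ShiftedHom.map, F.map_comp, F.map_comp, Category.assoc, Category.assoc]
        rw [h₀, ← Ext.mk₀_comp_mk₀, yonedaClass, Ext.comp_assoc_of_third_deg_zero,
          ShortComplex.ShortExact.extClass_comp_assoc, Ext.comp_zero])

end Comparison

end PhantomTower

end Towers

section Obstruction

variable {𝒯 : Type u₁} [Category.{v₁} 𝒯] [HasZeroObject 𝒯] [HasShift 𝒯 ℤ] [Preadditive 𝒯]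
  [∀ n : ℤ, (shiftFunctor 𝒯 n).Additive] [Pretriangulated 𝒯]
  {𝒜 : Type u₂} [Category.{v₂} 𝒜] [Abelian 𝒜]

/-- The comparison map `E₂^{p,q} → Ext^p(A, A'⟦q⟧)` for the ABC spectral sequence for
`𝒯(L.obj, L'.obj)`, where `L` and `L'` are liftings of `A` and `A'`. -/
def e₂ToExt [HasShift 𝒜 ℤ] [HasExt.{w} 𝒜] {I : MorphismProperty 𝒯} {F : 𝒯 ⥤ 𝒜} [F.CommShift ℤ]
    [F.IsHomological] (hF : Annihilates I F) {A A' : 𝒜} (L : Lifting I F A) (L' : Lifting I F A')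
    (t : PhantomTower I L.obj) (p : ℕ) (q : ℤ) :
    t.E₂ L'.obj p q →+ Ext.{w} A (A'⟦q⟧) p :=
  AddMonoidHom.mk' (fun x =>
    (Ext.mk₀ (L.iso.inv ≫ F.map t.base.inv)).comp
      ((t.toExt hF p q x).comp (Ext.mk₀ (L'.iso.hom⟦q⟧')) (add_zero p)) (zero_add p)) (by
    intro x x'
    rw [map_add, Ext.add_comp, Ext.comp_add])

/-- A projective resolution `0 ⟶ P₂ ⟶ P₁ ⟶ P₀ ⟶ A ⟶ 0`. -/
structure LengthTwoResolution (A : 𝒜) where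
  P₀ : 𝒜
  P₁ : 𝒜
  P₂ : 𝒜
  d₀ : P₀ ⟶ A
  d₁ : P₁ ⟶ P₀
  d₂ : P₂ ⟶ P₁
  d₁_d₀ : d₁ ≫ d₀ = 0
  d₂_d₁ : d₂ ≫ d₁ = 0
  projective₀ : Projective P₀
  projective₁ : Projective P₁
  projective₂ : Projective P₂
  epi₀ : Epi d₀
  exact₀ : (ShortComplex.mk d₁ d₀ d₁_d₀).Exact
  exact₁ : (ShortComplex.mk d₂ d₁ d₂_d₁).Exact
  mono₂ : Mono d₂

namespace LengthTwoResolution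

variable {A : 𝒜} (R : LengthTwoResolution A)

/-- The syzygy `ΩA = ker d₀` (which is also the image of `d₁`). -/
abbrev Ω : 𝒜 := kernel R.d₀

/-- The surjection `P₁ ⟶ ΩA` induced by `d₁`. -/
abbrev toΩ : R.P₁ ⟶ R.Ω := kernel.lift R.d₀ R.d₁ R.d₁_d₀

/-- The short exact sequence `ΩA ⟶ P₀ ⟶ A`. -/
lemma shortExact₀ :
    (ShortComplex.mk (kernel.ι R.d₀) R.d₀ (kernel.condition R.d₀)).ShortExact where
  exact := ShortComplex.exact_of_f_is_kernel _ (kernelIsKernel R.d₀)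
  mono_f := inferInstance
  epi_g := R.epi₀

lemma d₂_toΩ : R.d₂ ≫ R.toΩ = 0 := by
  rw [← cancel_mono (kernel.ι R.d₀), Category.assoc, kernel.lift_ι, R.d₂_d₁, zero_comp]

/-- The short exact sequence `P₂ ⟶ P₁ ⟶ ΩA`. -/
lemma shortExact₁ : (ShortComplex.mk R.d₂ R.toΩ R.d₂_toΩ).ShortExact where
  exact := by
    have hex := R.exact₁
    rw [ShortComplex.exact_iff_of_epi_of_isIso_of_mono
      (S₁ := ShortComplex.mk R.d₂ R.toΩ R.d₂_toΩ) (S₂ := ShortComplex.mk R.d₂ R.d₁ R.d₂_d₁)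
      { τ₁ := 𝟙 _, τ₂ := 𝟙 _, τ₃ := kernel.ι R.d₀ }]
    exact hex
  mono_f := R.mono₂
  epi_g := R.exact₀.epi_kernelLift

end LengthTwoResolution

/-- A lift to `𝒯` of the part `P₂ ⟶ P₁ ⟶ ΩA`, `P₀` of a length-two resolution of `A`: the
canonical liftings `Q₀, Q₁, Q₂` of `P₀, P₁, P₂`, and a lifting `D` of `ΩA` which is a cone of the
morphism `Q₂ ⟶ Q₁` lifting `d₂`. -/
structure LiftedResolution (I : MorphismProperty 𝒯) (F : 𝒯 ⥤ 𝒜) {A : 𝒜}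
    (R : LengthTwoResolution A) where
  Q₀ : AdjointLift F R.P₀
  Q₁ : AdjointLift F R.P₁
  Q₂ : AdjointLift F R.P₂
  D : Lifting I F R.Ω
  d₂ : Q₂.obj ⟶ Q₁.obj
  π₁ : Q₁.obj ⟶ D.obj
  ι₁ : ShiftedHom D.obj Q₂.obj (1 : ℤ)
  distinguished : Triangle.mk d₂ π₁ ι₁ ∈ distTriang 𝒯
  map_d₂ : F.map d₂ ≫ Q₁.iso.hom = Q₂.iso.hom ≫ R.d₂
  map_π₁ : F.map π₁ ≫ D.iso.hom = Q₁.iso.hom ≫ R.toΩ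

/-- A presentation of a lifting `L` of `A` as the cone of a morphism `φ : D ⟶ Q₀` that lifts the
inclusion `ΩA ⟶ P₀`, such that the morphism `Q₀ ⟶ L` lifts `d₀ : P₀ ⟶ A`. -/
structure ConePresentation {I : MorphismProperty 𝒯} {F : 𝒯 ⥤ 𝒜} {A : 𝒜}
    {R : LengthTwoResolution A} (S : LiftedResolution I F R) (L : Lifting I F A) where
  φ : S.D.obj ⟶ S.Q₀.obj
  π : S.Q₀.obj ⟶ L.obj
  θ : L.obj ⟶ S.D.obj⟦(1 : ℤ)⟧
  distinguished : Triangle.mk φ π θ ∈ distTriang 𝒯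
  map_φ : F.map φ ≫ S.Q₀.iso.hom = S.D.iso.hom ≫ kernel.ι R.d₀
  map_π : F.map π ≫ L.iso.hom = S.Q₀.iso.hom ≫ R.d₀

namespace LiftedResolution

variable {I : MorphismProperty 𝒯} {F : 𝒯 ⥤ 𝒜} [F.IsHomological] {A : 𝒜}
  {R : LengthTwoResolution A} (S : LiftedResolution I F R)

lemma map_sub_eq_zero {L L' : Lifting I F A} (C : ConePresentation S L)
    (C' : ConePresentation S L') : F.map (C.φ - C'.φ) = 0 := by
  rw [← cancel_mono S.Q₀.iso.hom, F.map_sub, Preadditive.sub_comp, C.map_φ, C'.map_φ, sub_self,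
    zero_comp]

/-- A morphism `f : D ⟶ B` with `F(f) = 0` factors through `ι₁`, by a map of degree `-1` out of
`Q₂`. -/
lemma exists_factor {B : 𝒯} (f : S.D.obj ⟶ B) (hf : F.map f = 0) :
    ∃ σ : ShiftedHom S.Q₂.obj B (-1 : ℤ),
      S.ι₁.comp σ (neg_add_cancel 1) = ShiftedHom.mk₀ (0 : ℤ) rfl f := by
  have h : S.π₁ ≫ f = 0 := by
    apply (S.Q₁.bijective B).1
    dsimp only
    rw [F.map_comp, hf, comp_zero, F.map_zero]
  refine exists_eq_shiftedHom_comp S.distinguished _ _ ?_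
  rw [ShiftedHom.mk₀, ← Category.assoc, h, zero_comp]

variable [HasShift 𝒜 ℤ] [F.CommShift ℤ] [HasExt.{w} 𝒜]

/-- The element of `Ext¹(ΩA, F(B)⟦-1⟧)` that corresponds to a morphism `f : D ⟶ B` with `F(f) = 0`
under the universal coefficient sequence
`Ext¹(ΩA, F(B)⟦-1⟧) ⟶ 𝒯(D, B) ⟶ Hom(ΩA, F(B))`:
write `f = σ ∘ ι₁` with `σ ∈ 𝒯(Q₂, B⟦-1⟧)`, and push the extension `P₂ ⟶ P₁ ⟶ ΩA` out along
`F(σ) : P₂ ⟶ F(B)⟦-1⟧`. -/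
def uctClass {B : 𝒯} (f : S.D.obj ⟶ B) (hf : F.map f = 0) :
    Ext.{w} R.Ω ((F.obj B)⟦(-1 : ℤ)⟧) 1 :=
  R.shortExact₁.extClass.comp
    (Ext.mk₀ (S.Q₂.iso.inv ≫ ShiftedHom.map (S.exists_factor f hf).choose F)) (add_zero 1)

/-- The class `uctClass f` can be computed with any factorization of `f`. -/
lemma uctClass_eq {B : 𝒯} (f : S.D.obj ⟶ B) (hf : F.map f = 0)
    (σ : ShiftedHom S.Q₂.obj B (-1 : ℤ))
    (hσ : S.ι₁.comp σ (neg_add_cancel 1) = ShiftedHom.mk₀ (0 : ℤ) rfl f) :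
    S.uctClass f hf =
      R.shortExact₁.extClass.comp (Ext.mk₀ (S.Q₂.iso.inv ≫ ShiftedHom.map σ F)) (add_zero 1) := by
  obtain ⟨z, hz⟩ : ∃ z : ShiftedHom S.Q₁.obj B (-1 : ℤ),
      S.d₂ ≫ z = (S.exists_factor f hf).choose + -σ := by
    refine exists_comp_eq_of_shiftedHom_comp_eq_zero S.distinguished (neg_add_cancel 1) _ ?_
    rw [ShiftedHom.comp_add, ShiftedHom.comp_neg, (S.exists_factor f hf).choose_spec, hσ,
      add_neg_cancel]
  have h₁ : (S.exists_factor f hf).choose = S.d₂ ≫ z + σ := by rw [hz, neg_add_cancel_right]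
  have h₂ : S.Q₂.iso.inv ≫ ShiftedHom.map (S.d₂ ≫ z) F =
      R.d₂ ≫ S.Q₁.iso.inv ≫ ShiftedHom.map z F := by
    have h₃ : S.Q₂.iso.inv ≫ F.map S.d₂ = R.d₂ ≫ S.Q₁.iso.inv := by
      rw [Iso.inv_comp_eq, ← Category.assoc, Iso.eq_comp_inv, S.map_d₂]
    rw [ShiftedHom.map, F.map_comp, Category.assoc, ← Category.assoc, h₃, Category.assoc,
      ShiftedHom.map]
  have h₄ : R.shortExact₁.extClass.comp
      (Ext.mk₀ (R.d₂ ≫ S.Q₁.iso.inv ≫ ShiftedHom.map z F)) (add_zero 1) = 0 := by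
    rw [← Ext.mk₀_comp_mk₀, ShortComplex.ShortExact.extClass_comp_assoc]
  rw [uctClass, h₁, ShiftedHom.map_add, Preadditive.comp_add, h₂, Ext.mk₀_add, Ext.comp_add, h₄,
    zero_add]

/-- The class in `Ext²(A, A⟦-1⟧)` of a morphism `f : D ⟶ Q₀` with `F(f) = 0`: the image of `f`
under `Ext¹(ΩA, P₀⟦-1⟧) ⟶ Ext¹(ΩA, A⟦-1⟧) ≅ Ext²(A, A⟦-1⟧)`. -/
def obstructionClass (f : S.D.obj ⟶ S.Q₀.obj) (hf : F.map f = 0) :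
    Ext.{w} A (A⟦(-1 : ℤ)⟧) 2 :=
  R.shortExact₀.extClass.comp
    ((S.uctClass f hf).comp (Ext.mk₀ ((S.Q₀.iso.hom ≫ R.d₀)⟦(-1 : ℤ)⟧')) (add_zero 1)) rfl

end LiftedResolution

/-- `c` is a relative obstruction class `δ(L, L')` of two liftings of `A`: if `L` and `L'` are
written as cones of `φ, φ' : D ⟶ Q₀`, it is the class of `φ - φ'`. -/
def IsRelativeObstructionClass {I : MorphismProperty 𝒯} {F : 𝒯 ⥤ 𝒜}
    [HasShift 𝒜 ℤ] [F.CommShift ℤ] [F.IsHomological] [HasExt.{w} 𝒜] {A : 𝒜} (L L' : Lifting I F A)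
    (c : Ext.{w} A (A⟦(-1 : ℤ)⟧) 2) : Prop :=
  ∃ (R : LengthTwoResolution A) (S : LiftedResolution I F R) (C : ConePresentation S L)
    (C' : ConePresentation S L'),
    S.obstructionClass (C.φ - C'.φ) (S.map_sub_eq_zero C C') = c

end Obstruction

end

end HomologicalIdeals

/-! One computation yields both the formula for the differential and the independence of choices.
Fix a phantom tower of `L₁` and cones `φ, φ' : D ⟶ Q₀` presenting `L₁` and `L₂`, with second maps
`π, π'`. Since the objects `P n` are projective, the identification of `N 0` with `L₁.obj` extends
to `u₀ : P 0 ⟶ Q₀`, `u₁ : N 1 ⟶ D` and `v : N 2 ⟶ Q₂`. The identity of `A` is represented by `u₀ ≫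
π'`. On `N 1` this becomes `u₁ ≫ φ ≫ π' = u₁ ≫ (φ - φ') ≫ π'`, because `φ' ≫ π' = 0`. As `F(φ - φ')
= 0`, the difference factors as `σ` after `ι₁`, so `d₂` of the identity is represented by `v`, `σ`
and a shift of `π'` composed in turn. Naturality of extension classes identifies its image in Ext²
with the obstruction class (`e₂ToExt_d₂_eq_obstructionClass`). The differential knows nothing of the
resolution and the cones, so the obstruction class does not depend on them. Antisymmetry is `φ' - φ
= -(φ - φ')`.

The input is that `I` is the kernel of `F` and that, for `I`-projective `P`, `F` is bijective on
morphisms out of `P` and `F(P)` is projective (`IsFullOnProjectives`). To get this from the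
universal property, send `B` to the triple `𝒯(P, B) → Hom(F(P), F(B))`, `F(B)`. This is a
homological functor to an abelian comma category and it kills `I`, so it factors through `F` by an
exact functor `H`, whose second component is the identity up to isomorphism. Chasing `𝟙 P` through
`H` gives fullness (`IsUniversalExact.map_surjective`) and projectivity
(`IsUniversalExact.projective`).

Dimension shifting along the tower then shows that the comparison maps to Ext are bijective. For
existence, two steps of a tower over `L₁.obj` end in an object that is orthogonal to contractible
objects and has projective image. Such an object is `I`-projective; here idempotents must split,
which countable sums ensure. -/

namespace HomologicalIdeals

noncomputable section

/-! ### Comma categories of a right exact and a left exact functor are abelian -/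

section CommaAbelian

universe v₃ u₃

variable {A : Type u₁} [Category.{v₁} A] {B : Type u₂} [Category.{v₂} B]
  {T : Type u₃} [Category.{v₃} T] (L : A ⥤ T) (R : B ⥤ T)

instance comma_fst_preservesLimitsOfShape {J : Type w} [Category.{v} J] [HasLimitsOfShape J A]
    [HasLimitsOfShape J B] [PreservesLimitsOfShape J R] :
    PreservesLimitsOfShape J (Comma.fst L R) where
  preservesLimit :=
    preservesLimit_of_preserves_limit_cone
      (Comma.coneOfPreservesIsLimit _ (limit.isLimit _) (limit.isLimit _))
      (limit.isLimit _)

instance comma_snd_preservesLimitsOfShape {J : Type w} [Category.{v} J] [HasLimitsOfShape J A]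
    [HasLimitsOfShape J B] [PreservesLimitsOfShape J R] :
    PreservesLimitsOfShape J (Comma.snd L R) where
  preservesLimit :=
    preservesLimit_of_preserves_limit_cone
      (Comma.coneOfPreservesIsLimit _ (limit.isLimit _) (limit.isLimit _))
      (limit.isLimit _)

lemma isIso_comma_of_isIso {X Y : Comma L R} (f : X ⟶ Y) [IsIso f.left] [IsIso f.right] :
    IsIso f := by
  have h : f = (Comma.isoMk (asIso f.left) (asIso f.right) f.w).hom := by
    ext <;> rfl
  rw [h]
  infer_instance

variable [Preadditive T] [Abelian A] [Abelian B] [L.Additive] [R.Additive]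
  [PreservesFiniteColimits L] [PreservesFiniteLimits R]

instance : PreservesFiniteLimits (Comma.fst L R) := ⟨fun _ _ _ => inferInstance⟩
instance : PreservesFiniteLimits (Comma.snd L R) := ⟨fun _ _ _ => inferInstance⟩
instance : PreservesFiniteColimits (Comma.fst L R) := ⟨fun _ _ _ => inferInstance⟩
instance : PreservesFiniteColimits (Comma.snd L R) := ⟨fun _ _ _ => inferInstance⟩

/-- The comma category of a right exact functor and a left exact functor is abelian. -/
instance commaAbelian : Abelian (Comma L R) := by
  have : ∀ {X Y : Comma L R} (f : X ⟶ Y), IsIso (Abelian.coimageImageComparison f) := by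
    intro X Y f
    -- Both projections are exact, so each carries the coimage-image comparison to the one of an
    -- abelian category, which is invertible.
    have h₁ : IsIso (Abelian.coimageImageComparison f).left := by
      change IsIso ((Comma.fst L R).map (Abelian.coimageImageComparison f))
      have := Arrow.isIso_iff_isIso_of_isIso
        (Abelian.PreservesCoimageImageComparison.iso (Comma.fst L R) f).hom
      rw [this]
      exact inferInstanceAs (IsIso (Abelian.coimageImageComparison ((Comma.fst L R).map f)))
    have h₂ : IsIso (Abelian.coimageImageComparison f).right := by
      change IsIso ((Comma.snd L R).map (Abelian.coimageImageComparison f))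
      have := Arrow.isIso_iff_isIso_of_isIso
        (Abelian.PreservesCoimageImageComparison.iso (Comma.snd L R) f).hom
      rw [this]
      exact inferInstanceAs (IsIso (Abelian.coimageImageComparison ((Comma.snd L R).map f)))
    exact isIso_comma_of_isIso L R _
  exact Abelian.ofCoimageImageComparisonIsIso

lemma comma_exact_iff (S : ShortComplex (Comma L R)) :
    S.Exact ↔ (S.map (Comma.fst L R)).Exact ∧ (S.map (Comma.snd L R)).Exact := by
  refine ⟨fun h => ⟨h.map _, h.map _⟩, fun ⟨h₁, h₂⟩ => ?_⟩
  simp only [ShortComplex.exact_iff_isZero_homology] at h₁ h₂ ⊢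
  have h₁' := h₁.of_iso (S.mapHomologyIso (Comma.fst L R)).symm
  have h₂' := h₂.of_iso (S.mapHomologyIso (Comma.snd L R)).symm
  rw [IsZero.iff_id_eq_zero]
  ext
  · exact h₁'.eq_of_src _ _
  · exact h₂'.eq_of_src _ _

end CommaAbelian

/-! ### Graded objects, which turn an arbitrary functor into a stable one -/

section Graded

variable {𝒞 : Type u₁} [Category.{v₁} 𝒞] {𝒟 : Type u₂} [Category.{v₂} 𝒟]

lemma functorCategory_exact_iff {K : Type w} [Category.{v} K] [Abelian 𝒞]
    (S : ShortComplex (K ⥤ 𝒞)) :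
    S.Exact ↔ ∀ k, (S.map ((evaluation K 𝒞).obj k)).Exact := by
  refine ⟨fun h k => h.map _, fun h => ?_⟩
  simp only [ShortComplex.exact_iff_isZero_homology] at h ⊢
  rw [IsZero.iff_id_eq_zero]
  ext k
  exact ((h k).of_iso (S.mapHomologyIso ((evaluation K 𝒞).obj k)).symm).eq_of_src _ _

variable (𝒞) in
/-- `ℤ`-graded objects, as functors on the discrete category `ℤ`. -/
abbrev Graded := Discrete ℤ ⥤ 𝒞

lemma Graded.app_comp_eqToHom {X Y : Graded 𝒞} (φ : X ⟶ Y) {a b : ℤ} (h : a = b) :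
    φ.app ⟨a⟩ ≫ eqToHom (by rw [h]) = eqToHom (by rw [h]) ≫ φ.app ⟨b⟩ := by
  subst h
  simp

/-- The translation functor on graded objects. -/
abbrev gradedTranslate (n : ℤ) : Graded 𝒞 ⥤ Graded 𝒞 where
  obj X := Discrete.functor fun k => X.obj ⟨n + k⟩
  map φ := Discrete.natTrans fun k => φ.app ⟨n + k.as⟩

/-- The shift structure on graded objects. -/
abbrev gradedShiftCore : ShiftMkCore (Graded 𝒞) ℤ where
  F := gradedTranslate
  zero := NatIso.ofComponents
    (fun X => Discrete.natIso fun k => eqToIso (by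
      change X.obj ⟨0 + k.as⟩ = X.obj ⟨k.as⟩
      rw [zero_add])) (by
      intro X Y φ
      ext k
      exact Graded.app_comp_eqToHom φ (zero_add k.as))
  add a b := NatIso.ofComponents
    (fun X => Discrete.natIso fun k => eqToIso (by
      change X.obj ⟨a + b + k.as⟩ = X.obj ⟨a + (b + k.as)⟩
      rw [add_assoc])) (by
      intro X Y φ
      ext k
      exact Graded.app_comp_eqToHom φ (add_assoc a b k.as))
  assoc_hom_app a b c X := by
    ext k
    simp only [NatTrans.comp_app, eqToHom_app]
    let e {i j : ℤ} (h : i = j) : X.obj ⟨i⟩ = X.obj ⟨j⟩ := by rw [h]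
    have H : eqToHom (e (add_assoc (a + b) c k.as)) ≫ eqToHom (e (add_assoc a b (c + k.as))) =
        eqToHom (e (by rw [add_assoc a])) ≫ eqToHom (e (add_assoc a (b + c) k.as)) ≫
          eqToHom (e (by rw [add_assoc b])) := by
      simp only [eqToHom_trans]
    exact H
  zero_add_hom_app a X := by
    ext k
    simp only [NatTrans.comp_app, eqToHom_app]
    let e {i j : ℤ} (h : i = j) : X.obj ⟨i⟩ = X.obj ⟨j⟩ := by rw [h]
    have H : eqToHom (e (add_assoc 0 a k.as)) =
        eqToHom (e (by rw [zero_add])) ≫ eqToHom (e (zero_add (a + k.as)).symm) := by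
      simp only [eqToHom_trans]
    exact H
  add_zero_hom_app a X := by
    ext k
    simp only [NatTrans.comp_app, eqToHom_app]
    let e {i j : ℤ} (h : i = j) : X.obj ⟨i⟩ = X.obj ⟨j⟩ := by rw [h]
    have H : eqToHom (e (add_assoc a 0 k.as)) =
        eqToHom (e (by rw [add_zero])) ≫ eqToHom (e (by rw [zero_add])) := by
      simp only [eqToHom_trans]
    exact H

instance : HasShift (Graded 𝒞) ℤ := hasShiftMk _ _ gradedShiftCore

instance [Preadditive 𝒞] (n : ℤ) : (shiftFunctor (Graded 𝒞) n).Additive where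
  map_add {X Y f g} := by
    ext k
    rfl

/-- The functor induced on graded objects by a functor. -/
abbrev gradedMap (U : 𝒞 ⥤ 𝒟) : Graded 𝒞 ⥤ Graded 𝒟 := (Functor.whiskeringRight _ _ _).obj U

instance (U : 𝒞 ⥤ 𝒟) : (gradedMap U).CommShift ℤ where
  commShiftIso n := NatIso.ofComponents (fun X => Discrete.natIso fun k => Iso.refl _) (by
    intro X Y f
    ext k
    change _ ≫ 𝟙 _ = 𝟙 _ ≫ _
    simp only [Category.comp_id, Category.id_comp]
    rfl)
  commShiftIso_zero := by
    ext X k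
    rw [Functor.CommShift.isoZero_hom_app]
    have h : (0 : ℤ) + k.as = k.as := zero_add _
    have H : 𝟙 _ = U.map (eqToHom (congrArg (fun i => X.obj ⟨i⟩) h)) ≫
        eqToHom (congrArg (fun i => U.obj (X.obj ⟨i⟩)) h.symm) := by
      rw [eqToHom_map, eqToHom_trans, eqToHom_refl]
    exact H
  commShiftIso_add a b := by
    ext X k
    rw [Functor.CommShift.isoAdd_hom_app]
    have h : a + b + k.as = a + (b + k.as) := add_assoc _ _ _
    have H : 𝟙 _ = U.map (eqToHom (congrArg (fun i => X.obj ⟨i⟩) h)) ≫ 𝟙 _ ≫ 𝟙 _ ≫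
        eqToHom (congrArg (fun i => U.obj (X.obj ⟨i⟩)) h.symm) := by
      rw [eqToHom_map, Category.id_comp, Category.id_comp, eqToHom_trans, eqToHom_refl]
    exact H

variable [HasShift 𝒟 ℤ]

/-- Associativity of the shift isomorphisms, solved for the term that occurs when `gradedOf` is
shifted by a sum; the `eqToHom` is the reindexing of degrees. -/
lemma shiftFunctorAdd_inv_app_comp_eqToHom (X : 𝒟) (a b k : ℤ) :
    (shiftFunctorAdd 𝒟 (a + b) k).inv.app X =
      ((shiftFunctorAdd 𝒟 a b).hom.app X)⟦k⟧' ≫ (shiftFunctorAdd 𝒟 b k).inv.app (X⟦a⟧) ≫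
        (shiftFunctorAdd 𝒟 a (b + k)).inv.app X ≫ eqToHom (by rw [add_assoc]) := by
  have h := shiftFunctorAdd'_assoc_inv_app (C := 𝒟) a b k (a + b) (b + k) (a + b + k) rfl rfl rfl X
  have h' : (shiftFunctorAdd' 𝒟 a (b + k) (a + b + k) (add_assoc a b k).symm).inv.app X =
      (shiftFunctorAdd 𝒟 a (b + k)).inv.app X ≫ eqToHom (by rw [add_assoc]) := by
    simp [shiftFunctorAdd']
  simp only [shiftFunctorAdd'_eq_shiftFunctorAdd] at h
  rw [h'] at h
  rw [← h, ← Functor.map_comp_assoc, Iso.hom_inv_id_app, CategoryTheory.Functor.map_id,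
    Category.id_comp]

/-- The graded functor `X ↦ (n ↦ U(X⟦n⟧))`. -/
abbrev gradedOf (U : 𝒟 ⥤ 𝒞) : 𝒟 ⥤ Graded 𝒞 where
  obj X := Discrete.functor fun k => U.obj (X⟦k⟧)
  map f := Discrete.natTrans fun k => U.map (f⟦k.as⟧')

instance (U : 𝒟 ⥤ 𝒞) : (gradedOf U).CommShift ℤ where
  commShiftIso n := NatIso.ofComponents (fun X => Discrete.natIso fun k =>
      U.mapIso ((shiftFunctorAdd 𝒟 n k.as).symm.app X)) (by
    intro X Y f
    ext k
    change U.map _ ≫ U.map _ = U.map _ ≫ U.map _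
    rw [← U.map_comp, ← U.map_comp]
    congr 1
    exact (shiftFunctorAdd 𝒟 n k.as).inv.naturality f)
  commShiftIso_zero := by
    ext X k
    rw [Functor.CommShift.isoZero_hom_app]
    refine (congrArg U.map (shiftFunctorAdd_zero_add_inv_app k.as X)).trans ?_
    refine (U.map_comp _ _).trans (congrArg (_ ≫ ·) ?_)
    exact eqToHom_map U _
  commShiftIso_add a b := by
    ext X k
    rw [Functor.CommShift.isoAdd_hom_app]
    refine (congrArg U.map (shiftFunctorAdd_inv_app_comp_eqToHom X a b k.as)).trans ?_
    refine (U.map_comp _ _).trans (congrArg (_ ≫ ·) ?_)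
    refine (U.map_comp _ _).trans (congrArg (_ ≫ ·) ?_)
    refine (U.map_comp _ _).trans (congrArg (_ ≫ ·) ?_)
    exact eqToHom_map U _

end Graded

/-! ### Exactness of graded functors -/

section GradedFunctors

variable {𝒞 : Type u₁} [Category.{v₁} 𝒞] {𝒟 : Type u₂} [Category.{v₂} 𝒟] [HasShift 𝒟 ℤ]

/-- Evaluation of `gradedOf U` in degree `k`. -/
def gradedOfEvaluation (U : 𝒟 ⥤ 𝒞) (k : Discrete ℤ) :
    gradedOf U ⋙ (evaluation _ _).obj k ≅ shiftFunctor 𝒟 k.as ⋙ U :=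
  NatIso.ofComponents (fun _ => Iso.refl _) (fun f => by
    exact (Category.comp_id _).trans (Category.id_comp _).symm)

instance (U : 𝒟 ⥤ 𝒞) [PreservesFiniteLimits U] : PreservesFiniteLimits (gradedOf U) :=
  preservesFiniteLimits_of_evaluation _ fun k =>
    preservesFiniteLimits_of_natIso (gradedOfEvaluation U k).symm

instance (U : 𝒟 ⥤ 𝒞) [PreservesFiniteColimits U] : PreservesFiniteColimits (gradedOf U) :=
  preservesFiniteColimits_of_evaluation _ fun k =>
    preservesFiniteColimits_of_natIso (gradedOfEvaluation U k).symm

variable [HasZeroObject 𝒟] [Preadditive 𝒟] [∀ n : ℤ, (shiftFunctor 𝒟 n).Additive]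
  [Pretriangulated 𝒟]

instance gradedOf_isHomological [Abelian 𝒞] (U : 𝒟 ⥤ 𝒞) [U.IsHomological] :
    (gradedOf U).IsHomological where
  map_zero X Y := by
    ext k
    change U.map ((0 : X ⟶ Y)⟦k.as⟧') = 0
    rw [Functor.map_zero, Functor.map_zero]
  exact T hT := by
    rw [functorCategory_exact_iff]
    intro k
    -- In degree `k` the sequence is a piece of the long exact homology sequence of `U`.
    let : U.ShiftSequence ℤ := Functor.ShiftSequence.tautological U ℤ
    exact U.homologySequence_exact₂ T hT k.as

end GradedFunctors

/-! ### Exact sections from the universal property -/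

section Universal

variable {𝒯 : Type u₁} [Category.{v₁} 𝒯] [HasShift 𝒯 ℤ]
  {𝒜 : Type u₂} [Category.{v₂} 𝒜] [HasShift 𝒜 ℤ]
  {𝓔 : Type u} [Category.{v} 𝓔] {𝓔' : Type*} [Category* 𝓔']

/-- An isomorphism `J ⋙ E ≅ F ⋙ ι` extends to graded objects. -/
def gradedIso (F : 𝒯 ⥤ 𝒜) [F.CommShift ℤ] {J : 𝒯 ⥤ 𝓔} {E : 𝓔 ⥤ 𝓔'} {ι : 𝒜 ⥤ 𝓔'}
    (α : J ⋙ E ≅ F ⋙ ι) : gradedOf J ⋙ gradedMap E ≅ F ⋙ gradedOf ι :=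
  NatIso.ofComponents (fun B => Discrete.natIso fun k =>
      α.app (B⟦k.as⟧) ≪≫ ι.mapIso ((F.commShiftIso k.as).app B)) (by
    intro X Y f
    ext k
    have h₁ := α.hom.naturality (f⟦k.as⟧')
    have h₂ := congrArg ι.map ((F.commShiftIso k.as).hom.naturality f)
    change E.map (J.map (f⟦k.as⟧')) ≫ α.hom.app _ ≫ ι.map ((F.commShiftIso k.as).hom.app Y) =
      (α.hom.app _ ≫ ι.map ((F.commShiftIso k.as).hom.app X)) ≫ ι.map ((F.map f)⟦k.as⟧')
    simp only [Functor.comp_map, Functor.map_comp] at h₁ h₂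
    rw [← Category.assoc, h₁, Category.assoc, Category.assoc, h₂])

instance (F : 𝒯 ⥤ 𝒜) [F.CommShift ℤ] {J : 𝒯 ⥤ 𝓔} {E : 𝓔 ⥤ 𝓔'} {ι : 𝒜 ⥤ 𝓔'}
    (α : J ⋙ E ≅ F ⋙ ι) : NatTrans.CommShift (gradedIso F α).hom ℤ where
  shift_comm n := by
    ext B k
    have h₁ := α.hom.naturality ((shiftFunctorAdd 𝒯 n k.as).inv.app B)
    have h₂ : F.map ((shiftFunctorAdd 𝒯 n k.as).inv.app B) ≫
        (F.commShiftIso (n + k.as)).hom.app B =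
        (F.commShiftIso k.as).hom.app (B⟦n⟧) ≫ ((F.commShiftIso n).hom.app B)⟦k.as⟧' ≫
          (shiftFunctorAdd 𝒜 n k.as).inv.app (F.obj B) := by
      rw [F.commShiftIso_add, Functor.CommShift.isoAdd_hom_app, ← F.map_comp_assoc,
        Iso.inv_hom_id_app, F.map_id, Category.id_comp]
    have H : (E.map (J.map ((shiftFunctorAdd 𝒯 n k.as).inv.app B)) ≫ 𝟙 _) ≫ α.hom.app _ ≫
          ι.map ((F.commShiftIso (n + k.as)).hom.app B) =
        (α.hom.app _ ≫ ι.map ((F.commShiftIso k.as).hom.app (B⟦n⟧))) ≫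
          ι.map (((F.commShiftIso n).hom.app B)⟦k.as⟧') ≫
          ι.map ((shiftFunctorAdd 𝒜 n k.as).inv.app (F.obj B)) := by
      simp only [Functor.comp_map] at h₁
      rw [Category.comp_id, ← Category.assoc, h₁, Category.assoc, ← ι.map_comp, h₂,
        ι.map_comp, ι.map_comp, Category.assoc]
      rfl
    simp only [NatTrans.comp_app, Functor.commShiftIso_comp_hom_app]
    exact H

variable [HasZeroObject 𝒯] [Preadditive 𝒯]
  [∀ n : ℤ, (shiftFunctor 𝒯 n).Additive] [Pretriangulated 𝒯] [Abelian 𝒜]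
  [Abelian 𝓔]

/-- A homological functor `J` with a retraction `pr` onto the universal functor `F` factors
through `F` by an exact section of `pr`. -/
lemma IsUniversalExact.exists_section {I : MorphismProperty 𝒯} {F : 𝒯 ⥤ 𝒜} [F.CommShift ℤ]
    [F.IsHomological] (hF : IsUniversalExact.{v₁, v₂, u₁, u₂, v, max v u} I F)
    (J : 𝒯 ⥤ 𝓔) [J.IsHomological]
    (hJ : ∀ ⦃X Y : 𝒯⦄ (f : X ⟶ Y) (n : ℤ), I f → J.map (f⟦n⟧') = 0)
    (pr : 𝓔 ⥤ 𝒜) (ι : 𝒜 ⥤ 𝓔) [PreservesFiniteLimits pr] [PreservesFiniteColimits pr]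
    [PreservesFiniteLimits ι] [PreservesFiniteColimits ι]
    (r : ι ⋙ pr ≅ 𝟭 𝒜) (e : J ⋙ pr ≅ F) :
    ∃ (H : 𝒜 ⥤ 𝓔) (_ : H.PreservesEpimorphisms),
      Nonempty (F ⋙ H ≅ J) ∧ Nonempty (H ⋙ pr ≅ 𝟭 𝒜) := by
  -- `J` need not commute with shifts, but its graded version does, so the universal property
  -- applies to that.
  obtain ⟨H, _, _, _, φ, _⟩ := hF.exists_factorization (Graded 𝓔) (gradedOf J) (by
    intro X Y f hf
    ext k
    exact hJ f k.as hf)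
  -- Uniqueness is available for targets in the universes of `Graded 𝓔`, which need not be those of
  -- `𝒜`. So the comparison of `H ⋙ pr` with the identity is carried out in `Graded 𝓔`, after
  -- applying `ι`; a further `pr` removes `ι` at the end.
  let α : J ⋙ (pr ⋙ ι) ≅ F ⋙ ι := (Functor.associator _ _ _).symm ≪≫ Functor.isoWhiskerRight e ι
  let ψ : F ⋙ (H ⋙ gradedMap (pr ⋙ ι)) ≅ F ⋙ gradedOf ι :=
    (Functor.associator _ _ _).symm ≪≫ Functor.isoWhiskerRight φ (gradedMap (pr ⋙ ι)) ≪≫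
      gradedIso F α
  have hψ : NatTrans.CommShift ψ.hom ℤ := by
    dsimp [ψ]
    infer_instance
  have := comp_preservesFiniteLimits pr ι
  have := comp_preservesFiniteColimits pr ι
  have : PreservesFiniteLimits (gradedMap (pr ⋙ ι)) := ⟨fun _ _ _ => inferInstance⟩
  have : PreservesFiniteColimits (gradedMap (pr ⋙ ι)) := ⟨fun _ _ _ => inferInstance⟩
  have := comp_preservesFiniteLimits H (gradedMap (pr ⋙ ι))
  have := comp_preservesFiniteColimits H (gradedMap (pr ⋙ ι))
  obtain ⟨θ⟩ := hF.unique_factorization (Graded 𝓔) (H ⋙ gradedMap (pr ⋙ ι)) (gradedOf ι) ψ hψ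
  let ev := (evaluation (Discrete ℤ) 𝓔).obj ⟨0⟩
  have hev : PreservesFiniteColimits ev := ⟨fun _ _ _ => inferInstance⟩
  refine ⟨H ⋙ ev, inferInstance, ⟨?_⟩, ⟨?_⟩⟩
  · exact (Functor.associator _ _ _).symm ≪≫ Functor.isoWhiskerRight φ ev ≪≫
      gradedOfEvaluation J ⟨0⟩ ≪≫ Functor.isoWhiskerRight (shiftFunctorZero 𝒯 ℤ) J ≪≫
      J.leftUnitor
  · have θ' : ((H ⋙ ev) ⋙ pr) ⋙ (ι ⋙ pr) ≅ shiftFunctor 𝒜 (0 : ℤ) ⋙ (ι ⋙ pr) :=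
      Functor.isoWhiskerRight (Functor.isoWhiskerRight θ ev) pr ≪≫
        Functor.isoWhiskerRight (gradedOfEvaluation ι ⟨0⟩) pr
    exact (Functor.rightUnitor _).symm ≪≫ Functor.isoWhiskerLeft _ r.symm ≪≫ θ' ≪≫
      Functor.isoWhiskerLeft _ r ≪≫ Functor.rightUnitor _ ≪≫ shiftFunctorZero 𝒜 ℤ

end Universal

/-! ### The abelian category of triples with a map to a Hom group -/

section HomPairs

variable {𝒯 : Type u₁} [Category.{v₁} 𝒯] [Preadditive 𝒯]
  {𝒜 : Type u₂} [Category.{v₂} 𝒜] [Abelian 𝒜]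

/-- The functor `X ↦ Hom(Y, X)` with values in abelian groups in a larger universe. -/
abbrev homGroup (Y : 𝒜) : 𝒜 ⥤ AddCommGrpCat.{max v₂ v} :=
  preadditiveCoyoneda.obj (Opposite.op Y) ⋙ AddCommGrpCat.uliftFunctor.{v, v₂}

instance (Y : 𝒜) : PreservesFiniteLimits (homGroup.{v₂, u₂, v} Y) :=
  comp_preservesFiniteLimits _ _

/-- Triples consisting of an abelian group `M`, an object `X` of `𝒜` and a homomorphism
`M → Hom(Y, X)`. -/
abbrev HomPair (Y : 𝒜) := Comma (𝟭 AddCommGrpCat.{max v₂ v}) (homGroup.{v₂, u₂, v} Y)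

section

variable (F : 𝒯 ⥤ 𝒜) [F.Additive] (P : 𝒯)

/-- The functor `B ↦ (𝒯(P, B), F(B))`. -/
def homPairFunctor : 𝒯 ⥤ HomPair.{v₂, u₂, max v₁ v} (F.obj P) where
  obj B :=
    { left := (preadditiveCoyoneda.obj (Opposite.op P) ⋙
        AddCommGrpCat.uliftFunctor.{max v₂ v, v₁}).obj B
      right := F.obj B
      hom := AddCommGrpCat.ofHom (AddEquiv.ulift.symm.toAddMonoidHom.comp
        ((F.mapAddHom (X := P) (Y := B)).comp AddEquiv.ulift.toAddMonoidHom)) }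
  map {B B'} f :=
    { left := (preadditiveCoyoneda.obj (Opposite.op P) ⋙
        AddCommGrpCat.uliftFunctor.{max v₂ v, v₁}).map f
      right := F.map f
      w := by
        ext ⟨x⟩
        exact congrArg ULift.up (F.map_comp x f) }

end

open ZeroObject in
/-- The inclusion of `𝒜` into triples with trivial group component. -/
def homPairInclusion (Y : 𝒜) : 𝒜 ⥤ HomPair.{v₂, u₂, v} Y where
  obj X :=
    { left := 0
      right := X
      hom := 0 }
  map f :=
    { left := 0
      right := f
      w := zero_comp.trans zero_comp.symm }
  map_id X := by
    ext1
    · exact (isZero_zero _).eq_of_src _ _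
    · rfl
  map_comp f g := by
    ext1
    · exact (isZero_zero _).eq_of_src _ _
    · rfl

instance (Y : 𝒜) : (homPairInclusion.{v₂, u₂, v} Y).Additive where
  map_add {X X' f g} := by
    ext1
    · exact (add_zero _).symm
    · rfl

lemma homPairInclusion_exact (Y : 𝒜) (S : ShortComplex 𝒜) (hS : S.Exact) :
    (S.map (homPairInclusion.{v₂, u₂, v} Y)).Exact := by
  rw [comma_exact_iff]
  exact ⟨ShortComplex.exact_of_isZero_X₂ _ (isZero_zero _), hS⟩

instance (Y : 𝒜) : PreservesFiniteLimits (homPairInclusion.{v₂, u₂, v} Y) :=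
  (((Functor.exact_tfae (homPairInclusion Y)).out 1 3 :
    _ ↔ PreservesFiniteLimits _ ∧ PreservesFiniteColimits _).1 (homPairInclusion_exact Y)).1

instance (Y : 𝒜) : PreservesFiniteColimits (homPairInclusion.{v₂, u₂, v} Y) :=
  (((Functor.exact_tfae (homPairInclusion Y)).out 1 3 :
    _ ↔ PreservesFiniteLimits _ ∧ PreservesFiniteColimits _).1 (homPairInclusion_exact Y)).2

end HomPairs

/-! ### Fullness and projectivity on `I`-projective objects -/

section Universal

variable {𝒯 : Type u₁} [Category.{v₁} 𝒯] [HasZeroObject 𝒯] [HasShift 𝒯 ℤ] [Preadditive 𝒯]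
  [∀ n : ℤ, (shiftFunctor 𝒯 n).Additive] [Pretriangulated 𝒯]
  {𝒜 : Type u₂} [Category.{v₂} 𝒜] [Abelian 𝒜] [HasShift 𝒜 ℤ]

instance (F : 𝒯 ⥤ 𝒜) [F.IsHomological] (P : 𝒯) :
    (homPairFunctor.{v₁, v₂, u₁, u₂, v} F P).IsHomological where
  map_zero X Y := by
    ext1
    · exact Functor.map_zero (preadditiveCoyoneda.obj (Opposite.op P) ⋙
        AddCommGrpCat.uliftFunctor.{max v₂ v, v₁}) X Y
    · exact F.map_zero _ _
  exact T hT := by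
    rw [comma_exact_iff]
    refine ⟨?_, F.map_distinguished_exact T hT⟩
    exact ((preadditiveCoyoneda.obj (Opposite.op P)).map_distinguished_exact T hT).map
      AddCommGrpCat.uliftFunctor.{max v₂ v, v₁}

lemma IsStableHomologicalIdeal.shift {I : MorphismProperty 𝒯}
    (hI : IsStableHomologicalIdeal.{v₁, u₁, v, u} I) {X Y : 𝒯} (f : X ⟶ Y) (hf : I f) (n : ℤ) :
    I (f⟦n⟧') := by
  obtain ⟨𝓑, _, _, _, _, G, _, _, hG⟩ := hI
  rw [hG] at hf ⊢
  rw [← cancel_mono ((G.commShiftIso n).hom.app Y), Functor.commShiftIso_hom_naturality, hf]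
  simp

/-- A functor with kernel `I` factors through `F`, so it kills whatever `F` kills. -/
lemma IsStableHomologicalIdeal.iff_map_eq_zero {I : MorphismProperty 𝒯} {F : 𝒯 ⥤ 𝒜}
    [F.CommShift ℤ] [F.IsHomological]
    (hI : IsStableHomologicalIdeal.{v₁, u₁, v, u} I)
    (hF : IsUniversalExact.{v₁, v₂, u₁, u₂, v, u} I F) {X Y : 𝒯} (f : X ⟶ Y) :
    I f ↔ F.map f = 0 := by
  refine ⟨fun h => hF.annihilates f h, fun h => ?_⟩
  obtain ⟨𝓑, _, _, _, _, G, _, _, hG⟩ := hI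
  obtain ⟨H, _, _, _, e, _⟩ := hF.exists_factorization 𝓑 G (fun _ _ g hg => (hG g).1 hg)
  have : H.PreservesZeroMorphisms := inferInstance
  rw [hG, ← NatIso.naturality_1 e f, Functor.comp_map, h]
  simp

variable {I : MorphismProperty 𝒯} {F : 𝒯 ⥤ 𝒜} [F.CommShift ℤ] [F.IsHomological]

/-- For an `I`-projective object `P`, the pairs `(𝒯(P, B), F(B))` yield an exact functor on the
target of the universal `I`-exact functor `F`. -/
lemma IsUniversalExact.exists_homPair
    (hI : IsStableHomologicalIdeal.{v₁, u₁, max u₁ u₂ v₁ v₂, (max u₁ u₂ v₁ v₂) + 1} I)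
    (hF : IsUniversalExact.{v₁, v₂, u₁, u₂, max u₁ u₂ v₁ v₂, (max u₁ u₂ v₁ v₂) + 1} I F)
    (P : 𝒯) (hP : IsProjectiveFor I P) :
    ∃ (H : 𝒜 ⥤ HomPair.{v₂, u₂, max v₁ u₁ u₂} (F.obj P)) (_ : H.PreservesEpimorphisms),
      Nonempty (F ⋙ H ≅ homPairFunctor.{v₁, v₂, u₁, u₂, max u₁ u₂} F P) ∧
        Nonempty (H ⋙ Comma.snd _ _ ≅ 𝟭 𝒜) := by
  refine hF.exists_section _ ?_ _ (homPairInclusion _) (Iso.refl _) (Iso.refl _)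
  intro X Y f n hf
  have hf' := hI.shift f hf n
  ext1
  · ext ⟨x⟩
    exact congrArg ULift.up (hP _ hf' x)
  · exact hF.annihilates _ hf'

/-- The group component of `H.map a` is a homomorphism from `𝒯(P, P)` to `𝒯(P, B)`, and the image of
`𝟙 P` is the lift `f`. Compatibility with the maps to Hom groups, evaluated at `𝟙 P`, says that
`F(f)` is the second component. So `H` takes `F(f)` and `a` to morphisms with equal second
components, and these determine the morphism in `𝒜`. -/
lemma IsUniversalExact.map_surjective
    (hI : IsStableHomologicalIdeal.{v₁, u₁, max u₁ u₂ v₁ v₂, (max u₁ u₂ v₁ v₂) + 1} I)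
    (hF : IsUniversalExact.{v₁, v₂, u₁, u₂, max u₁ u₂ v₁ v₂, (max u₁ u₂ v₁ v₂) + 1} I F)
    {P : 𝒯} (hP : IsProjectiveFor I P) {B : 𝒯} (a : F.obj P ⟶ F.obj B) :
    ∃ f : P ⟶ B, F.map f = a := by
  obtain ⟨H, _, ⟨e⟩, ⟨r⟩⟩ := hF.exists_homPair hI P hP
  let j := e.inv.app P ≫ H.map a ≫ e.hom.app B
  let f : P ⟶ B := (j.left (ULift.up (𝟙 P))).down
  have h₁ : j.right = F.map f := by
    have h := congrArg ULift.down (congrArg (fun φ => φ (ULift.up (𝟙 P))) j.w)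
    have h' : F.map f = F.map (𝟙 P) ≫ j.right := h
    exact ((congrArg (· ≫ j.right) (F.map_id P)).trans (Category.id_comp _)).symm.trans h'.symm
  have h₂ : e.inv.app P ≫ H.map (F.map f) ≫ e.hom.app B = (homPairFunctor F P).map f :=
    NatIso.naturality_1 e f
  have h₃ : (e.inv.app P ≫ H.map (F.map f) ≫ e.hom.app B).right = j.right := by
    rw [h₂, h₁]
    rfl
  have h₄ : (Comma.snd _ _).map (H.map (F.map f)) = (Comma.snd _ _).map (H.map a) := by
    have h : ((Comma.snd _ _).map (e.inv.app P ≫ H.map (F.map f) ≫ e.hom.app B)) =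
      (Comma.snd _ _).map j := h₃
    simpa only [j, Functor.map_comp, cancel_epi, cancel_mono] using h
  refine ⟨f, ?_⟩
  rw [← Functor.id_map (F.map f), ← Functor.id_map a, ← NatIso.naturality_1 r (F.map f),
    ← NatIso.naturality_1 r a]
  exact congrArg (fun x => r.inv.app _ ≫ x ≫ r.hom.app _) h₄

/-- `H` preserves an epimorphism onto `F(P)`, so in the group component `𝟙 P` has a preimage `μ`.
The homomorphism to the Hom group turns `μ` into a section. -/
lemma IsUniversalExact.projective
    (hI : IsStableHomologicalIdeal.{v₁, u₁, max u₁ u₂ v₁ v₂, (max u₁ u₂ v₁ v₂) + 1} I)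
    (hF : IsUniversalExact.{v₁, v₂, u₁, u₂, max u₁ u₂ v₁ v₂, (max u₁ u₂ v₁ v₂) + 1} I F)
    {P : 𝒯} (hP : IsProjectiveFor I P) : Projective (F.obj P) := by
  obtain ⟨H, _, ⟨e⟩, ⟨r⟩⟩ := hF.exists_homPair hI P hP
  have key : ∀ {X : 𝒜} (q : X ⟶ F.obj P) [Epi q], ∃ s, s ≫ q = 𝟙 (F.obj P) := by
    intro X q _
    let g : H.obj X ⟶ (homPairFunctor F P).obj P := H.map q ≫ e.hom.app P
    have hg : Epi ((Comma.fst _ _).map g) := inferInstance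
    obtain ⟨μ, hμ⟩ := (AddCommGrpCat.epi_iff_surjective _).1 hg (ULift.up (𝟙 P))
    let σ : F.obj P ⟶ (H.obj X).right := ((H.obj X).hom μ).down
    have h₁ : σ ≫ g.right = 𝟙 _ := by
      have h := congrArg ULift.down (congrArg (fun φ => φ μ) g.w)
      have hμ' : g.left μ = ULift.up (𝟙 P) := hμ
      have h' : (((homPairFunctor F P).obj P).hom (g.left μ)).down = σ ≫ g.right := h
      rw [← h', hμ']
      exact F.map_id P
    let ε : (H.obj (F.obj P)).right ≅ F.obj P := (Comma.snd _ _).mapIso (e.app P)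
    have h₂ : g.right = (H.map q).right ≫ ε.hom := rfl
    let ρ (Y : 𝒜) : (H.obj Y).right ≅ Y := r.app Y
    have h₃ : (H.map q).right ≫ (ρ _).hom = (ρ _).hom ≫ q := r.hom.naturality q
    -- The identifications `ε` and `ρ` of the second component of `H.obj (F.obj P)` with `F.obj P`
    -- need not agree; `ρ⁻¹ ≫ ε` corrects the discrepancy.
    refine ⟨((ρ _).inv ≫ ε.hom) ≫ σ ≫ (ρ _).hom, ?_⟩
    have h₄ : σ ≫ (H.map q).right = ε.inv := by
      rw [← cancel_mono ε.hom, ε.inv_hom_id, Category.assoc, ← h₂]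
      exact h₁
    simp only [Category.assoc]
    rw [← h₃, reassoc_of% h₄]
    simp
  exact ⟨fun {E X} f g _ => by
    obtain ⟨s, hs⟩ := key (pullback.fst f g)
    refine ⟨s ≫ pullback.snd f g, ?_⟩
    rw [Category.assoc, ← pullback.condition, reassoc_of% hs]⟩

end Universal

/-! ### Splitting idempotents by an infinite sum -/

section Idempotents

variable {𝒯 : Type u₁} [Category.{v₁} 𝒯] [HasZeroObject 𝒯] [HasShift 𝒯 ℤ] [Preadditive 𝒯]
  [∀ n : ℤ, (shiftFunctor 𝒯 n).Additive] [Pretriangulated 𝒯]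

/-- Split monomorphisms in a pretriangulated category have complements. -/
lemma exists_complement {X Y : 𝒯} (f : X ⟶ Y) (g : Y ⟶ X) (hfg : f ≫ g = 𝟙 X) :
    ∃ (Z : 𝒯) (k : Y ⟶ Z) (s : Z ⟶ Y), f ≫ k = 0 ∧ s ≫ k = 𝟙 Z ∧ k ≫ s = 𝟙 Y - g ≫ f := by
  obtain ⟨Z, k, h, hT⟩ := distinguished_cocone_triangle f
  have h₁ : f ≫ k = 0 := comp_distTriang_mor_zero₁₂ _ hT
  have h₂ : h = 0 := by
    have h₃ : h ≫ f⟦(1 : ℤ)⟧' = 0 := comp_distTriang_mor_zero₃₁ _ hT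
    have h₄ := congrArg (· ≫ g⟦(1 : ℤ)⟧') h₃
    simpa only [Category.assoc, ← Functor.map_comp, hfg, CategoryTheory.Functor.map_id,
      Category.comp_id, zero_comp] using h₄
  have hk : Epi k := Triangle.epi₂ _ hT h₂
  obtain ⟨s, hs⟩ : ∃ s : Z ⟶ Y, 𝟙 Y - g ≫ f = k ≫ s :=
    Triangle.yoneda_exact₂ _ hT _ (by
      change f ≫ (𝟙 Y - g ≫ f) = 0
      rw [Preadditive.comp_sub, Category.comp_id, reassoc_of% hfg, sub_self])
  refine ⟨Z, k, s, h₁, ?_, hs.symm⟩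
  rw [← cancel_epi k, ← Category.assoc, ← hs, Preadditive.sub_comp, Category.assoc, h₁,
    comp_zero, sub_zero, Category.id_comp, Category.comp_id]

/-- Idempotents split in a pretriangulated category with countable coproducts. -/
lemma exists_splitting [HasCountableCoproducts 𝒯] {X : 𝒯} (e : X ⟶ X) (he : e ≫ e = e) :
    ∃ (Y : 𝒯) (i : Y ⟶ X) (p : X ⟶ Y), i ≫ p = 𝟙 Y ∧ p ≫ i = e := by
  obtain ⟨d, hd⟩ : ∃ d, d = 𝟙 X - e := ⟨_, rfl⟩
  have hed : e ≫ d = 0 := by simp [hd, he]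
  have hde : d ≫ e = 0 := by simp [hd, he]
  have hdd : d ≫ d = d := by nth_rw 1 [hd]; simp [hed]
  have hsum : d + e = 𝟙 X := by simp [hd]
  let ι (n : ℕ) := Sigma.ι (fun _ : ℕ => X) n
  -- Eilenberg swindle: `f` fixes the `d`-part of every summand and moves the `e`-part one summand
  -- up; `g` moves the `e`-part back down and kills it in summand 0. Hence `f ≫ g = 𝟙`, and what the
  -- split monomorphism `f` misses is the `e`-part of summand 0, which splits `e`.
  let f : (∐ fun _ : ℕ => X) ⟶ ∐ fun _ : ℕ => X :=
    Sigma.desc fun n => d ≫ ι n + e ≫ ι (n + 1)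
  let g : (∐ fun _ : ℕ => X) ⟶ ∐ fun _ : ℕ => X :=
    Sigma.desc fun n => d ≫ ι n + n.casesOn 0 fun m => e ≫ ι m
  let q : (∐ fun _ : ℕ => X) ⟶ X := Sigma.desc fun n => n.casesOn (𝟙 X) fun _ => 0
  have hf (n : ℕ) : ι n ≫ f = d ≫ ι n + e ≫ ι (n + 1) := Sigma.ι_desc _ _
  have hg₀ : ι 0 ≫ g = d ≫ ι 0 := (Sigma.ι_desc _ _).trans (add_zero _)
  have hg (n : ℕ) : ι (n + 1) ≫ g = d ≫ ι (n + 1) + e ≫ ι n := Sigma.ι_desc _ _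
  have hq₀ : ι 0 ≫ q = 𝟙 X := Sigma.ι_desc _ _
  have hdg (n : ℕ) : d ≫ ι n ≫ g = d ≫ ι n := by
    cases n with
    | zero => rw [hg₀, reassoc_of% hdd]
    | succ n => rw [hg, Preadditive.comp_add, reassoc_of% hdd, reassoc_of% hde, zero_comp, add_zero]
  have hfg : f ≫ g = 𝟙 _ := by
    refine Sigma.hom_ext _ _ fun n => ?_
    change ι n ≫ f ≫ g = ι n ≫ 𝟙 _
    rw [← Category.assoc, hf, Preadditive.add_comp, Category.assoc, Category.assoc, hdg, hg,
      Preadditive.comp_add, reassoc_of% hed, reassoc_of% he, zero_comp, zero_add,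
      ← Preadditive.add_comp, hsum, Category.id_comp, Category.comp_id]
  obtain ⟨Y, k, s, hfk, hsk, hks⟩ := exists_complement f g hfg
  have hdf (n : ℕ) : d ≫ ι n ≫ f = d ≫ ι n := by
    rw [hf, Preadditive.comp_add, reassoc_of% hdd, reassoc_of% hde, zero_comp, add_zero]
  have hef (n : ℕ) : e ≫ ι n ≫ f = e ≫ ι (n + 1) := by
    rw [hf, Preadditive.comp_add, reassoc_of% hed, reassoc_of% he, zero_comp, zero_add]
  have hgf₀ : ι 0 ≫ (𝟙 _ - g ≫ f) = e ≫ ι 0 := by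
    rw [Preadditive.comp_sub, Category.comp_id, reassoc_of% hg₀, hdf, sub_eq_iff_eq_add',
      ← Preadditive.add_comp, hsum, Category.id_comp]
  have hgf (n : ℕ) : ι (n + 1) ≫ (𝟙 _ - g ≫ f) = 0 := by
    rw [Preadditive.comp_sub, Category.comp_id, reassoc_of% (hg n), Preadditive.add_comp,
      Category.assoc, Category.assoc, hdf, hef, ← Preadditive.add_comp, hsum, Category.id_comp,
      sub_self]
  have hk : (𝟙 _ - g ≫ f) ≫ k = k := by
    rw [Preadditive.sub_comp, Category.assoc, hfk, comp_zero, sub_zero, Category.id_comp]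
  refine ⟨Y, s ≫ q, ι 0 ≫ k, ?_, ?_⟩
  · have : Epi k := ⟨fun a b hab => by
      rw [← Category.id_comp a, ← Category.id_comp b, ← hsk, Category.assoc, hab, Category.assoc]⟩
    rw [← cancel_epi k]
    refine Sigma.hom_ext _ _ fun n => ?_
    change ι n ≫ k ≫ (s ≫ q) ≫ ι 0 ≫ k = ι n ≫ k ≫ 𝟙 _
    have hk' (m : ℕ) : ι m ≫ k = (ι m ≫ (𝟙 _ - g ≫ f)) ≫ k := by rw [Category.assoc, hk]
    rw [Category.comp_id, Category.assoc, reassoc_of% hks, ← Category.assoc]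
    cases n with
    | zero => rw [hgf₀, Category.assoc, reassoc_of% hq₀, ← Category.assoc, ← hgf₀, ← hk']
    | succ n => rw [hgf, zero_comp, hk', hgf, zero_comp]
  · rw [Category.assoc, reassoc_of% hks, ← Category.assoc, hgf₀, Category.assoc, hq₀,
      Category.comp_id]

end Idempotents

/-! ### Objects orthogonal to contractible objects -/

section Orthogonal

variable {𝒯 : Type u₁} [Category.{v₁} 𝒯] [HasZeroObject 𝒯] [HasShift 𝒯 ℤ] [Preadditive 𝒯]
  [∀ n : ℤ, (shiftFunctor 𝒯 n).Additive] [Pretriangulated 𝒯]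
  {𝒜 : Type u₂} [Category.{v₂} 𝒜] [Abelian 𝒜]

/-- `N` has no nonzero morphisms to `I`-contractible objects. -/
def IsOrthogonalTo (I : MorphismProperty 𝒯) (N : 𝒯) : Prop :=
  ∀ B : 𝒯, IsContractibleFor I B → ∀ f : N ⟶ B, f = 0

/-- `F` has kernel `I`, is full on morphisms out of `I`-projective objects, and preserves
projectivity. -/
structure IsFullOnProjectives (I : MorphismProperty 𝒯) (F : 𝒯 ⥤ 𝒜) : Prop where
  map_eq_zero_iff : ∀ ⦃X Y : 𝒯⦄ (f : X ⟶ Y), I f ↔ F.map f = 0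
  map_surjective : ∀ ⦃P : 𝒯⦄, IsProjectiveFor I P → ∀ ⦃B : 𝒯⦄ (a : F.obj P ⟶ F.obj B),
    ∃ f : P ⟶ B, F.map f = a
  projective : ∀ ⦃P : 𝒯⦄, IsProjectiveFor I P → Projective (F.obj P)

lemma IsUniversalExact.isFullOnProjectives [HasShift 𝒜 ℤ]
    {I : MorphismProperty 𝒯} {F : 𝒯 ⥤ 𝒜} [F.CommShift ℤ] [F.IsHomological]
    (hI : IsStableHomologicalIdeal.{v₁, u₁, max u₁ u₂ v₁ v₂, (max u₁ u₂ v₁ v₂) + 1} I)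
    (hF : IsUniversalExact.{v₁, v₂, u₁, u₂, max u₁ u₂ v₁ v₂, (max u₁ u₂ v₁ v₂) + 1} I F) :
    IsFullOnProjectives I F where
  map_eq_zero_iff _ _ f := hI.iff_map_eq_zero hF f
  map_surjective _ hP _ a := hF.map_surjective hI hP a
  projective _ hP := hF.projective hI hP

omit [HasZeroObject 𝒯] [HasShift 𝒯 ℤ] [∀ n : ℤ, (shiftFunctor 𝒯 n).Additive]
  [Pretriangulated 𝒯] in
lemma IsProjectiveFor.isOrthogonalTo {I : MorphismProperty 𝒯} {P : 𝒯}
    (hP : IsProjectiveFor I P) : IsOrthogonalTo I P := fun B hB f => by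
  rw [← Category.comp_id f]
  exact hP _ hB f

omit [HasZeroObject 𝒯] [HasShift 𝒯 ℤ] [∀ n : ℤ, (shiftFunctor 𝒯 n).Additive]
  [Pretriangulated 𝒯] in
lemma IsProjectiveFor.of_retract {I : MorphismProperty 𝒯} {P Q : 𝒯}
    (hP : IsProjectiveFor I P) (i : Q ⟶ P) (p : P ⟶ Q) (h : i ≫ p = 𝟙 Q) :
    IsProjectiveFor I Q := fun X Y f hf g => by
  rw [← Category.id_comp g, ← h, Category.assoc, Category.assoc, ← Category.assoc p,
    hP f hf, comp_zero]

namespace IsFullOnProjectives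

variable {I : MorphismProperty 𝒯} {F : 𝒯 ⥤ 𝒜} [F.IsHomological] (hF : IsFullOnProjectives I F)

include hF

lemma map_injective {P B : 𝒯} (hP : IsProjectiveFor I P) {f g : P ⟶ B}
    (h : F.map f = F.map g) : f = g := by
  rw [← sub_eq_zero, ← Category.id_comp (f - g)]
  exact hP _ ((hF.map_eq_zero_iff _).2 (by rw [F.map_sub, h, sub_self])) _

/-- Because `F(g)` is invertible, `F` kills the cone of `g`, which is therefore contractible. So
`N'` has only the zero map to the cone, and its identity lifts along `g`. -/
lemma exists_section [HasShift 𝒜 ℤ] [F.CommShift ℤ] {N N' : 𝒯} (hN' : IsOrthogonalTo I N')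
    (g : N ⟶ N') [IsIso (F.map g)] : ∃ s : N' ⟶ N, s ≫ g = 𝟙 N' := by
  obtain ⟨C, k, h, hT⟩ := distinguished_cocone_triangle g
  have hk : F.map k = 0 := by
    rw [← cancel_epi (F.map g), ← F.map_comp, comp_zero]
    exact (congrArg F.map (comp_distTriang_mor_zero₁₂ _ hT)).trans (F.map_zero _ _)
  have hh : F.map h = 0 := by
    have : IsIso (F.map (g⟦(1 : ℤ)⟧')) :=
      (NatIso.isIso_map_iff (F.commShiftIso (1 : ℤ)) g).2
        (inferInstanceAs (IsIso ((F.map g)⟦(1 : ℤ)⟧')))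
    rw [← cancel_mono (F.map (g⟦(1 : ℤ)⟧')), ← F.map_comp, zero_comp]
    exact (congrArg F.map (comp_distTriang_mor_zero₃₁ _ hT)).trans (F.map_zero _ _)
  have hC : IsZero (F.obj C) :=
    (F.map_distinguished_exact _ (rot_of_distTriang _ hT)).isZero_of_both_zeros hk hh
  have hk' : k = 0 := hN' C ((hF.map_eq_zero_iff _).2 (hC.eq_of_src _ _)) k
  obtain ⟨s, hs⟩ : ∃ s : N' ⟶ N, 𝟙 N' = s ≫ g :=
    Triangle.coyoneda_exact₂ _ hT (𝟙 N') (by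
      change 𝟙 N' ≫ k = 0
      rw [hk', comp_zero])
  exact ⟨s, hs.symm⟩

/-- A section of `g` is also inverted by `F`, so it has a section in turn, and this can only be `g`.
-/
lemma isIso_of_isIso_map [HasShift 𝒜 ℤ] [F.CommShift ℤ] {N N' : 𝒯} (hN : IsOrthogonalTo I N)
    (hN' : IsOrthogonalTo I N') (g : N ⟶ N') [IsIso (F.map g)] : IsIso g := by
  obtain ⟨s, hs⟩ := hF.exists_section hN' g
  have hs' : F.map s = inv (F.map g) := by
    rw [← cancel_mono (F.map g), ← F.map_comp, hs, F.map_id, IsIso.inv_hom_id]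
  have : IsIso (F.map s) := by rw [hs']; infer_instance
  obtain ⟨t, ht⟩ := hF.exists_section hN s
  have htg : t = g := by rw [← Category.comp_id t, ← hs, reassoc_of% ht]
  exact ⟨s, by rw [← htg, ht], hs⟩

lemma epi_map_of_isEpicFor {X Y : 𝒯} {f : X ⟶ Y} (hf : IsEpicFor I f) : Epi (F.map f) := by
  obtain ⟨Z, g, h, hT, hg⟩ := hf
  exact (F.map_distinguished_exact _ hT).epi_f ((hF.map_eq_zero_iff _).1 hg)

/-- An object orthogonal to contractible objects whose image under `F` is projective is
`I`-projective. -/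
lemma isProjectiveFor_of_projective [HasCountableCoproducts 𝒯] [HasShift 𝒜 ℤ] [F.CommShift ℤ]
    (hI : HasEnoughProjectives I) {N : 𝒯} (hN : IsOrthogonalTo I N) [Projective (F.obj N)] :
    IsProjectiveFor I N := by
  obtain ⟨Q, q, hQ, hq⟩ := hI N
  have := hF.epi_map_of_isEpicFor hq
  obtain ⟨a, ha⟩ : ∃ a, a ≫ F.map q = 𝟙 _ :=
    ⟨Projective.factorThru (𝟙 _) (F.map q), Projective.factorThru_comp _ _⟩
  -- The section `a` exists only in `𝒜`, but the idempotent `F.map q ≫ a` lifts to `Q`. Its image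
  -- `Y` maps to `N` by a morphism that `F` inverts, and then `N` is a retract of `Y`.
  obtain ⟨e, he⟩ := hF.map_surjective hQ (F.map q ≫ a)
  have hee : e ≫ e = e := hF.map_injective hQ (by
    rw [F.map_comp, he, Category.assoc, reassoc_of% ha])
  obtain ⟨Y, i, p, hip, hpi⟩ := exists_splitting e hee
  have hY : IsProjectiveFor I Y := hQ.of_retract i p hip
  have hpi' : F.map p ≫ F.map i = F.map q ≫ a := by rw [← F.map_comp, hpi, he]
  have hip' : F.map i ≫ F.map p = 𝟙 _ := by rw [← F.map_comp, hip, F.map_id]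
  have : IsIso (F.map (i ≫ q)) := ⟨a ≫ F.map p, by
    rw [F.map_comp, Category.assoc, ← reassoc_of% hpi', hip', Category.comp_id, hip'], by
    rw [F.map_comp, Category.assoc, reassoc_of% hpi', ha, Category.comp_id, ha]⟩
  obtain ⟨s, hs⟩ := hF.exists_section hN (i ≫ q)
  exact hY.of_retract s _ hs

end IsFullOnProjectives

end Orthogonal

/-! ### Phantom towers and dimension shifting -/

section Towers

variable {𝒯 : Type u₁} [Category.{v₁} 𝒯] [HasZeroObject 𝒯] [HasShift 𝒯 ℤ] [Preadditive 𝒯]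
  [∀ n : ℤ, (shiftFunctor 𝒯 n).Additive] [Pretriangulated 𝒯]
  {𝒜 : Type u₂} [Category.{v₂} 𝒜] [Abelian 𝒜]
  {I : MorphismProperty 𝒯} {F : 𝒯 ⥤ 𝒜} [F.IsHomological]

lemma IsFullOnProjectives.exists_triangle (hF : IsFullOnProjectives I F)
    (hI : HasEnoughProjectives I) (X : 𝒯) :
    ∃ (N P : 𝒯) (φ : N ⟶ P) (π : P ⟶ X) (ι : X ⟶ N⟦(1 : ℤ)⟧),
      IsProjectiveFor I P ∧ Triangle.mk φ π ι ∈ distTriang 𝒯 ∧ I ι := by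
  obtain ⟨P, π, hP, hπ⟩ := hI X
  obtain ⟨N, φ, ι, hT⟩ := distinguished_cocone_triangle₁ π
  refine ⟨N, P, φ, π, ι, hP, hT, ?_⟩
  have := hF.epi_map_of_isEpicFor hπ
  rw [hF.map_eq_zero_iff, ← cancel_epi (F.map π), ← F.map_comp, comp_zero]
  exact (congrArg F.map (comp_distTriang_mor_zero₂₃ _ hT)).trans (F.map_zero _ _)

lemma IsFullOnProjectives.nonempty_phantomTower (hF : IsFullOnProjectives I F)
    (hI : HasEnoughProjectives I) (X : 𝒯) : Nonempty (PhantomTower I X) := by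
  choose N P φ π ι hP hT hι using hF.exists_triangle hI
  let M : ℕ → 𝒯 := fun n => n.rec X fun _ Y => N Y
  exact ⟨{
    N := M
    P := fun n => P (M n)
    φ := fun n => φ (M n)
    π := fun n => π (M n)
    ι := fun n => ι (M n)
    base := Iso.refl _
    projective := fun n => hP (M n)
    distinguished := fun n => hT (M n)
    phantom := fun n => hι (M n) }⟩

omit [HasZeroObject 𝒯] [∀ n : ℤ, (shiftFunctor 𝒯 n).Additive] [Pretriangulated 𝒯]
  [F.IsHomological] in
lemma IsFullOnProjectives.exists_shiftedHom_map_eq [HasShift 𝒜 ℤ] [F.CommShift ℤ]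
    (hF : IsFullOnProjectives I F) {P B : 𝒯} (hP : IsProjectiveFor I P) {q : ℤ}
    (a : F.obj P ⟶ (F.obj B)⟦q⟧) :
    ∃ x : ShiftedHom P B q, ShiftedHom.map x F = a := by
  obtain ⟨x, hx⟩ := hF.map_surjective hP (a ≫ (F.commShiftIso q).inv.app B)
  refine ⟨x, ?_⟩
  rw [ShiftedHom.map, hx, Category.assoc, Iso.inv_hom_id_app]
  exact Category.comp_id _

lemma IsFullOnProjectives.shiftedHom_map_injective [HasShift 𝒜 ℤ] [F.CommShift ℤ]
    (hF : IsFullOnProjectives I F) {P B : 𝒯} (hP : IsProjectiveFor I P) {q : ℤ}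
    {x y : ShiftedHom P B q} (h : ShiftedHom.map x F = ShiftedHom.map y F) : x = y := by
  rw [ShiftedHom.map, ShiftedHom.map, cancel_mono] at h
  exact hF.map_injective hP h

namespace PhantomTower

variable [HasShift 𝒜 ℤ] [F.CommShift ℤ] [HasExt.{w} 𝒜] {X : 𝒯} (t : PhantomTower I X)
  (hF : IsFullOnProjectives I F) (hF' : Annihilates I F)

include hF

/-- Dimension shifting: a class of positive degree vanishes on the projective object `F(P p)`, so it
factors through the next connecting class. -/
lemma exists_yonedaClass_comp_eq {Y : 𝒜} (p j : ℕ) {n : ℕ} (h : p + j = n)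
    (x : Ext.{w} (F.obj (t.N 0)) Y n) :
    ∃ z : Ext.{w} (F.obj (t.N p)) Y j, (t.yonedaClass hF' p).comp z h = x := by
  induction p generalizing j with
  | zero =>
    obtain rfl : j = n := by omega
    exact ⟨x, Ext.mk₀_id_comp x⟩
  | succ p ih =>
    obtain ⟨z, hz⟩ := ih (j + 1) (by omega)
    have := hF.projective (t.projective p)
    obtain ⟨z', hz'⟩ := Ext.contravariant_sequence_exact₃ (t.shortExact hF' p) _ z
      (Ext.eq_zero_of_projective _) (add_comm 1 j)
    refine ⟨z', ?_⟩
    rw [yonedaClass, Ext.comp_assoc (h₂₃ := add_comm 1 j) (h := by omega), hz', hz]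

/-- The degree must be positive. In degree 0 and for `p > 0` the morphisms killed are those that
extend over `F(P (p-1))`, and these account for the boundaries of `d₁`. -/
lemma eq_zero_of_yonedaClass_comp_eq_zero {Y : 𝒜} (p j : ℕ) {n : ℕ} (h : p + (j + 1) = n)
    (z : Ext.{w} (F.obj (t.N p)) Y (j + 1)) (hz : (t.yonedaClass hF' p).comp z h = 0) :
    z = 0 := by
  induction p generalizing j n with
  | zero =>
    obtain rfl : j + 1 = n := by omega
    exact (Ext.mk₀_id_comp z).symm.trans hz
  | succ p ih =>
    rw [yonedaClass, Ext.comp_assoc (a₂₃ := j + 1 + 1) (h₂₃ := by omega)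
      (h := by omega)] at hz
    have := hF.projective (t.projective p)
    obtain ⟨z', rfl⟩ := Ext.contravariant_sequence_exact₁ (t.shortExact hF' p) _ z (by omega)
      (ih _ _ _ hz)
    rw [Ext.eq_zero_of_projective z', Ext.comp_zero]

/-- Dimension shifting writes a class as the push-out along some `f : F(N p) ⟶ F(B)⟦q⟧`. Fullness
lifts `F(π) ≫ f` to a map out of `P p`, and faithfulness on `P (p+1)` makes it a cycle. -/
lemma toExt_surjective (B : 𝒯) (p : ℕ) (q : ℤ) :
    Function.Surjective (t.toExt (B := B) hF' p q : _ →+ Ext.{w} _ _ _) := by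
  intro e
  obtain ⟨z, hz⟩ := t.exists_yonedaClass_comp_eq hF hF' p 0 (add_zero p) e
  obtain ⟨f, rfl⟩ := (Ext.mk₀_bijective _ _).2 z
  obtain ⟨x, hx⟩ := hF.exists_shiftedHom_map_eq (t.projective p) (F.map (t.π p) ≫ f)
  have hx' : x ∈ t.cycles B p q := by
    change t.π (p + 1) ≫ t.φ p ≫ x = 0
    refine hF.shiftedHom_map_injective (t.projective (p + 1)) ?_
    rw [ShiftedHom.map_zero, ShiftedHom.map, F.map_comp, F.map_comp]
    rw [ShiftedHom.map] at hx
    rw [Category.assoc, Category.assoc, hx, reassoc_of% map_comp_eq_zero F (t.distinguished p),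
      zero_comp, comp_zero]
  refine ⟨QuotientAddGroup.mk ⟨x, hx'⟩, ?_⟩
  have hf : t.descCycle hF' p q ⟨x, hx'⟩ = f := by
    have := (t.shortExact hF' p).epi_g
    dsimp only at this
    rw [← cancel_epi (F.map (t.π p)), map_comp_descCycle, hx]
  change (t.yonedaClass hF' p).comp (Ext.mk₀ (t.descCycle hF' p q ⟨x, hx'⟩)) (add_zero p) = _
  rw [hf, hz]

lemma toExt_injective (B : 𝒯) (p : ℕ) (q : ℤ) :
    Function.Injective (t.toExt (B := B) hF' p q : _ →+ Ext.{w} _ _ _) := by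
  rw [injective_iff_map_eq_zero]
  intro e he
  obtain ⟨x, rfl⟩ := QuotientAddGroup.mk_surjective e
  change (t.yonedaClass hF' p).comp (Ext.mk₀ (t.descCycle hF' p q x)) (add_zero p) = 0 at he
  refine (QuotientAddGroup.eq_zero_iff _).2 ?_
  cases p with
  | zero =>
    have h₀ : t.descCycle hF' 0 q x = 0 :=
      (Ext.mk₀_eq_zero_iff _).1 ((Ext.mk₀_id_comp _).symm.trans he)
    have h₁ := t.map_comp_descCycle hF' 0 q x
    rw [h₀, comp_zero] at h₁
    exact hF.shiftedHom_map_injective (t.projective 0) (h₁.symm.trans (ShiftedHom.map_zero F).symm)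
  | succ p =>
    rw [yonedaClass, Ext.comp_assoc_of_third_deg_zero] at he
    have h₀ := t.eq_zero_of_yonedaClass_comp_eq_zero hF hF' p 0 rfl _ he
    obtain ⟨z, hz⟩ := Ext.contravariant_sequence_exact₁ (t.shortExact hF' p) _ _ (add_zero 1) h₀
    obtain ⟨b, rfl⟩ := (Ext.mk₀_bijective _ _).2 z
    rw [Ext.mk₀_comp_mk₀] at hz
    have hb : F.map (t.φ p) ≫ b = t.descCycle hF' (p + 1) q x := (Ext.mk₀_bijective _ _).1 hz
    obtain ⟨y, rfl⟩ := hF.exists_shiftedHom_map_eq (t.projective p) b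
    refine ⟨y, ?_⟩
    refine hF.shiftedHom_map_injective (t.projective (p + 1)) ?_
    refine Eq.trans ?_ (t.map_comp_descCycle hF' (p + 1) q x)
    rw [← hb]
    change ShiftedHom.map (t.π (p + 1) ≫ t.φ p ≫ y) F = _
    rw [ShiftedHom.map, F.map_comp, F.map_comp, Category.assoc, Category.assoc]
    rfl

end PhantomTower

lemma e₂ToExt_bijective [HasShift 𝒜 ℤ] [F.CommShift ℤ] [HasExt.{w} 𝒜]
    (hF : IsFullOnProjectives I F) (hF' : Annihilates I F) {A A' : 𝒜} (L : Lifting I F A)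
    (L' : Lifting I F A') (t : PhantomTower I L.obj) (p : ℕ) (q : ℤ) :
    Function.Bijective (e₂ToExt.{w} hF' L L' t p q) := by
  let α : F.obj (t.N 0) ≅ A := F.mapIso t.base ≪≫ L.iso
  let β : (F.obj L'.obj)⟦q⟧ ≅ A'⟦q⟧ := (shiftFunctor 𝒜 q).mapIso L'.iso
  have h (x) : e₂ToExt.{w} hF' L L' t p q x = (Ext.mk₀ α.inv).comp
      ((t.toExt hF' p q x).comp (Ext.mk₀ β.hom) (add_zero p)) (zero_add p) := rfl
  have h' (x) : t.toExt hF' p q x = (Ext.mk₀ α.hom).comp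
      ((e₂ToExt.{w} hF' L L' t p q x).comp (Ext.mk₀ β.inv) (add_zero p)) (zero_add p) := by
    rw [h]
    simp
  refine ⟨fun x y hxy => t.toExt_injective hF hF' _ p q (by rw [h', hxy, ← h']), fun y => ?_⟩
  obtain ⟨x, hx⟩ := t.toExt_surjective hF hF' L'.obj p q ((Ext.mk₀ α.hom).comp
    (y.comp (Ext.mk₀ β.inv) (add_zero p)) (zero_add p))
  refine ⟨x, ?_⟩
  rw [h, hx]
  simp

end Towers

/-- The two naturality squares trade the extensions of a tower for those of a resolution; the
remaining comparison `a` cancels against `T`. -/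
lemma comp_comp_eq_of_naturality {𝒜 : Type u₂} [Category.{v₂} 𝒜] [Abelian 𝒜] [HasExt.{w} 𝒜]
    {A N₀ N₁ N₂ Ω P B B' : 𝒜} (T : Ext.{w} A N₀ 0)
    (E₀ : Ext.{w} N₀ N₁ 1) (E₁ : Ext.{w} N₁ N₂ 1) (R₀ : Ext.{w} A Ω 1) (R₁ : Ext.{w} Ω P 1)
    (a : Ext.{w} N₀ A 0) (b : Ext.{w} N₁ Ω 0) (c : Ext.{w} N₂ P 0) (m : Ext.{w} P B 0)
    (m' : Ext.{w} B B' 0) (hT : T.comp a (zero_add 0) = Ext.mk₀ (𝟙 A))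
    (h₀ : E₀.comp b (add_zero 1) = a.comp R₀ (zero_add 1))
    (h₁ : E₁.comp c (add_zero 1) = b.comp R₁ (zero_add 1)) :
    T.comp (((((Ext.mk₀ (𝟙 N₀)).comp E₀ (zero_add 1)).comp E₁ (show 1 + 1 = 2 from rfl)).comp
        (c.comp (m.comp m' (zero_add 0)) (zero_add 0)) (add_zero 2))) (zero_add 2) =
      R₀.comp ((R₁.comp m (add_zero 1)).comp m' (add_zero 1)) rfl := by
  have h₂ : E₁.comp (c.comp (m.comp m' (zero_add 0)) (zero_add 0)) (add_zero 1) =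
      b.comp ((R₁.comp m (add_zero 1)).comp m' (add_zero 1)) (zero_add 1) := by
    rw [← Ext.comp_assoc_of_second_deg_zero, h₁, Ext.comp_assoc_of_third_deg_zero,
      Ext.comp_assoc_of_third_deg_zero R₁ m m']
  rw [Ext.mk₀_id_comp, Ext.comp_assoc_of_third_deg_zero, h₂, ← Ext.comp_assoc_of_second_deg_zero,
    h₀, Ext.comp_assoc a R₀ _ (zero_add 1) rfl rfl,
    ← Ext.comp_assoc T a _ (zero_add 0) (zero_add 2) rfl, hT, Ext.mk₀_id_comp]

/-! ### The second differential of the identity -/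

section Differential

variable {𝒯 : Type u₁} [Category.{v₁} 𝒯] [HasZeroObject 𝒯] [HasShift 𝒯 ℤ] [Preadditive 𝒯]
  [∀ n : ℤ, (shiftFunctor 𝒯 n).Additive] [Pretriangulated 𝒯]
  {𝒜 : Type u₂} [Category.{v₂} 𝒜] [Abelian 𝒜]
  {I : MorphismProperty 𝒯} {F : 𝒯 ⥤ 𝒜} [F.IsHomological]

lemma AdjointLift.isProjectiveFor {P : 𝒜} (Q : AdjointLift F P) (hF' : Annihilates I F) :
    IsProjectiveFor I Q.obj := fun X Y f hf g => (Q.bijective Y).1 (by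
  dsimp only
  rw [F.map_comp, hF' f hf, comp_zero, F.map_zero])

lemma IsFullOnProjectives.mor₃_mem (hF : IsFullOnProjectives I F) {X Y Z : 𝒯} {f : X ⟶ Y}
    {g : Y ⟶ Z} {h : Z ⟶ X⟦(1 : ℤ)⟧} (hT : Triangle.mk f g h ∈ distTriang 𝒯) [Epi (F.map g)] :
    I h := by
  rw [hF.map_eq_zero_iff, ← cancel_epi (F.map g), ← F.map_comp, comp_zero]
  exact (congrArg F.map (comp_distTriang_mor_zero₂₃ _ hT)).trans (F.map_zero _ _)

/-- A morphism of third objects extends to a morphism of triangles if the second object of the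
first triangle is `I`-projective and the third morphism of the second one is in `I`. -/
lemma exists_triangle_lift {X Y Z X' Y' Z' : 𝒯} {f : X ⟶ Y} {g : Y ⟶ Z} {h : Z ⟶ X⟦(1 : ℤ)⟧}
    {f' : X' ⟶ Y'} {g' : Y' ⟶ Z'} {h' : Z' ⟶ X'⟦(1 : ℤ)⟧}
    (hT : Triangle.mk f g h ∈ distTriang 𝒯) (hT' : Triangle.mk f' g' h' ∈ distTriang 𝒯)
    (hY : IsProjectiveFor I Y) (hh' : I h') (c : Z ⟶ Z') :
    ∃ (a : X ⟶ X') (b : Y ⟶ Y'), f ≫ b = a ≫ f' ∧ g ≫ c = b ≫ g' ∧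
      h ≫ a⟦(1 : ℤ)⟧' = c ≫ h' := by
  obtain ⟨b, hb⟩ : ∃ b : Y ⟶ Y', g ≫ c = b ≫ g' :=
    Triangle.coyoneda_exact₃ _ hT' (g ≫ c) (hY _ hh' _)
  obtain ⟨a, ha₁, ha₂⟩ := complete_distinguished_triangle_morphism₁ _ _ hT hT' b c hb
  exact ⟨a, b, ha₁, hb, ha₂⟩

omit [F.IsHomological] in
lemma LiftedResolution.epi_map_π₁ {A : 𝒜} {R : LengthTwoResolution A}
    (S : LiftedResolution I F R) : Epi (F.map S.π₁) := by
  have := R.shortExact₁.epi_g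
  have h : F.map S.π₁ = (S.Q₁.iso.hom ≫ R.toΩ) ≫ S.D.iso.inv := by
    rw [← S.map_π₁, Category.assoc, Iso.hom_inv_id, Category.comp_id]
  rw [h]
  infer_instance

omit [F.IsHomological] in
lemma ConePresentation.epi_map_π {A : 𝒜} {R : LengthTwoResolution A}
    {S : LiftedResolution I F R} {L : Lifting I F A} (C : ConePresentation S L) :
    Epi (F.map C.π) := by
  have := R.epi₀
  have h : F.map C.π = (S.Q₀.iso.hom ≫ R.d₀) ≫ L.iso.inv := by
    rw [← C.map_π, Category.assoc, Iso.hom_inv_id, Category.comp_id]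
  rw [h]
  infer_instance

variable [HasShift 𝒜 ℤ] [F.CommShift ℤ] [HasExt.{w} 𝒜]

/-- For `p = 0` the comparison map involves no extension, only isomorphisms. Undoing them leaves the
identification of `F(N 0)` with `F(L₂.obj)` through `A`. -/
lemma descCycle_eq_of_e₂ToExt_eq (hF' : Annihilates I F) {A : 𝒜} (L₁ L₂ : Lifting I F A)
    (t : PhantomTower I L₁.obj) (x : t.cycles L₂.obj 0 0)
    (hx : e₂ToExt.{w} hF' L₁ L₂ t 0 0 (QuotientAddGroup.mk x) =
      Ext.mk₀ ((shiftFunctorZero 𝒜 ℤ).inv.app A)) :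
    t.descCycle hF' 0 0 x =
      ShiftedHom.mk₀ (0 : ℤ) rfl (F.map t.base.hom ≫ L₁.iso.hom ≫ L₂.iso.inv) := by
  have h₁ : (Ext.mk₀ (L₁.iso.inv ≫ F.map t.base.inv)).comp
      (((Ext.mk₀ (𝟙 _)).comp (Ext.mk₀ (t.descCycle hF' 0 0 x)) (add_zero 0)).comp
        (Ext.mk₀ (L₂.iso.hom⟦(0 : ℤ)⟧')) (add_zero 0)) (zero_add 0) =
      Ext.mk₀ ((shiftFunctorZero 𝒜 ℤ).inv.app A) := hx
  rw [Ext.mk₀_comp_mk₀, Category.id_comp, Ext.mk₀_comp_mk₀, Ext.mk₀_comp_mk₀] at h₁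
  have h₂ := (Ext.mk₀_bijective _ _).1 h₁
  have h₃ := (shiftFunctorZero 𝒜 ℤ).inv.naturality L₂.iso.inv
  dsimp only [Functor.id_obj, Functor.id_map] at h₃
  rw [← cancel_epi (L₁.iso.inv ≫ F.map t.base.inv), ← cancel_mono (L₂.iso.hom⟦(0 : ℤ)⟧'),
    Category.assoc, h₂, ShiftedHom.mk₀, shiftFunctorZero', Iso.trans_inv, eqToIso_refl]
  have h₄ : (L₁.iso.inv ≫ F.map t.base.inv) ≫ F.map t.base.hom ≫ L₁.iso.hom ≫ L₂.iso.inv =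
      L₂.iso.inv := by
    rw [Category.assoc, ← F.map_comp_assoc, Iso.inv_hom_id, F.map_id, Category.id_comp,
      Iso.inv_hom_id_assoc]
  simp only [Category.assoc, Iso.refl_inv, Category.comp_id] at h₄ ⊢
  rw [reassoc_of% h₄, reassoc_of% h₃, ← Functor.map_comp, Iso.inv_hom_id, (shiftFunctor 𝒜 0).map_id,
    Category.comp_id]

/-- The second differential of the ABC spectral sequence sends the identity to the relative
obstruction class. -/
lemma e₂ToExt_d₂_eq_obstructionClass (hF : IsFullOnProjectives I F) (hF' : Annihilates I F) {A : 𝒜}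
    {L₁ L₂ : Lifting I F A} (t : PhantomTower I L₁.obj) {R : LengthTwoResolution A}
    (S : LiftedResolution I F R) (C : ConePresentation S L₁) (C' : ConePresentation S L₂)
    (x : t.E₂ L₂.obj 0 0)
    (hx : e₂ToExt.{w} hF' L₁ L₂ t 0 0 x = Ext.mk₀ ((shiftFunctorZero 𝒜 ℤ).inv.app A)) :
    e₂ToExt.{w} hF' L₁ L₂ t 2 (-1) (t.d₂ 0 (neg_add_cancel 1) x) =
      S.obstructionClass (C.φ - C'.φ) (S.map_sub_eq_zero C C') := by
  obtain ⟨x, rfl⟩ := QuotientAddGroup.mk_surjective x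
  have hx' := descCycle_eq_of_e₂ToExt_eq hF' L₁ L₂ t x hx
  have := C.epi_map_π
  have := S.epi_map_π₁
  -- Compare the first two triangles of the tower with the two triangles of the lifted resolution.
  obtain ⟨u₁, u₀, hu₁, hu₀, -⟩ := exists_triangle_lift (t.distinguished 0) C.distinguished
    (t.projective 0) (hF.mor₃_mem C.distinguished) t.base.hom
  obtain ⟨v, w₁, hv, hw₁, hv'⟩ := exists_triangle_lift (t.distinguished 1) S.distinguished
    (t.projective 1) (hF.mor₃_mem S.distinguished) u₁
  have hxu : (x : ShiftedHom (t.P 0) L₂.obj (0 : ℤ)) =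
      ShiftedHom.mk₀ (0 : ℤ) rfl (u₀ ≫ C'.π) := by
    refine hF.shiftedHom_map_injective (t.projective 0) ?_
    rw [← t.map_comp_descCycle hF', hx', ShiftedHom.map_mk₀]
    have h : F.map (t.π 0) ≫ F.map t.base.hom ≫ L₁.iso.hom ≫ L₂.iso.inv =
        F.map (u₀ ≫ C'.π) := by
      rw [← cancel_mono L₂.iso.hom]
      simp only [Category.assoc, Iso.inv_hom_id, Category.comp_id, F.map_comp]
      rw [C'.map_π, ← C.map_π, ← F.map_comp_assoc, hu₀, F.map_comp_assoc]
    rw [← h]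
    simp only [ShiftedHom.mk₀, Category.assoc]
  obtain ⟨σ, hσ⟩ := S.exists_factor (C.φ - C'.φ) (S.map_sub_eq_zero C C')
  -- `k x` is `u₁ ≫ C.φ ≫ C'.π`, and `C.φ` may be replaced by `C.φ - C'.φ` because `C'.φ ≫ C'.π =
  -- 0`. Factoring this difference through `S.ι₁` and using `hv'` to replace `u₁` followed by `S.ι₁`
  -- by `t.ι 1` followed by the shift of `v` shows `k x = i y`.
  let y : ShiftedHom (t.N 2) L₂.obj (-1 : ℤ) := v ≫ σ ≫ C'.π⟦(-1 : ℤ)⟧'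
  have hy : t.coupleI L₂.obj 1 (neg_add_cancel 1) y = t.coupleK L₂.obj 0 0 x := by
    change (t.ι 1).comp y (neg_add_cancel 1) = t.φ 0 ≫ (x : ShiftedHom (t.P 0) L₂.obj (0 : ℤ))
    have h₁ : C'.φ ≫ C'.π = 0 := comp_distTriang_mor_zero₁₂ _ C'.distinguished
    have h₂ : (t.ι 1).comp y (neg_add_cancel 1) =
        u₁ ≫ S.ι₁.comp σ (neg_add_cancel 1) ≫ C'.π⟦(0 : ℤ)⟧' := by
      simp only [ShiftedHom.comp, y, Functor.map_comp, Category.assoc]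
      rw [reassoc_of% hv']
      have h₃ := (shiftFunctorAdd' 𝒯 (-1) 1 0 (neg_add_cancel 1)).inv.naturality C'.π
      dsimp only [Functor.comp_map] at h₃
      rw [h₃]
    rw [h₂, hσ, hxu]
    have h₃ := (shiftFunctorZero' 𝒯 (0 : ℤ) rfl).inv.naturality C'.π
    dsimp only [Functor.id_map, Functor.id_obj] at h₃
    simp only [ShiftedHom.mk₀, Category.assoc]
    rw [reassoc_of% hu₁, ← h₃, ← Category.assoc (C.φ - C'.φ), Preadditive.sub_comp, h₁, sub_zero,
      Category.assoc]
  rw [t.d₂_mk (neg_add_cancel 1) x y hy, LiftedResolution.obstructionClass,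
    S.uctClass_eq _ _ σ hσ]
  have hdesc : t.descCycle hF' 2 (-1) ⟨t.coupleJ L₂.obj 2 (-1) y, t.coupleJ_mem_cycles 2 (-1) y⟩ =
      F.map v ≫ ShiftedHom.map σ F ≫ (F.map C'.π)⟦(-1 : ℤ)⟧' := by
    have := (t.shortExact hF' 2).epi_g
    dsimp only at this
    rw [← cancel_epi (F.map (t.π 2)), PhantomTower.map_comp_descCycle]
    change F.map (t.π 2 ≫ v ≫ σ ≫ C'.π⟦(-1 : ℤ)⟧') ≫ _ = _
    simp only [F.map_comp, ShiftedHom.map, Category.assoc]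
    simp [Functor.commShiftIso_hom_naturality]
  have h₀ := ShortComplex.ShortExact.extClass_naturality (t.shortExact hF' 0) R.shortExact₀
    { τ₁ := F.map u₁ ≫ S.D.iso.hom
      τ₂ := F.map u₀ ≫ S.Q₀.iso.hom
      τ₃ := F.map t.base.hom ≫ L₁.iso.hom
      comm₁₂ := by
        dsimp
        rw [Category.assoc, ← C.map_φ, ← F.map_comp_assoc, ← hu₁, F.map_comp_assoc]
      comm₂₃ := by
        dsimp
        rw [Category.assoc, ← C.map_π, ← F.map_comp_assoc, ← hu₀, F.map_comp_assoc] }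
  have h₁ := ShortComplex.ShortExact.extClass_naturality (t.shortExact hF' 1) R.shortExact₁
    { τ₁ := F.map v ≫ S.Q₂.iso.hom
      τ₂ := F.map w₁ ≫ S.Q₁.iso.hom
      τ₃ := F.map u₁ ≫ S.D.iso.hom
      comm₁₂ := by
        dsimp
        rw [Category.assoc, ← S.map_d₂, ← F.map_comp_assoc, ← hv, F.map_comp_assoc]
      comm₂₃ := by
        dsimp
        rw [Category.assoc, ← S.map_π₁, ← F.map_comp_assoc, ← hw₁, F.map_comp_assoc] }
  have h₂ : F.map v ≫ ShiftedHom.map σ F ≫ (F.map C'.π)⟦(-1 : ℤ)⟧' ≫ L₂.iso.hom⟦(-1 : ℤ)⟧' =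
      (F.map v ≫ S.Q₂.iso.hom) ≫ (S.Q₂.iso.inv ≫ ShiftedHom.map σ F) ≫
        (S.Q₀.iso.hom ≫ R.d₀)⟦(-1 : ℤ)⟧' := by
    rw [← C'.map_π]
    simp
  have h₃ : (L₁.iso.inv ≫ F.map t.base.inv) ≫ F.map t.base.hom ≫ L₁.iso.hom = 𝟙 A := by
    rw [Category.assoc, ← F.map_comp_assoc, Iso.inv_hom_id, F.map_id, Category.id_comp,
      Iso.inv_hom_id]
  change (Ext.mk₀ (L₁.iso.inv ≫ F.map t.base.inv)).comp
      (((t.yonedaClass hF' 2).comp (Ext.mk₀ (t.descCycle hF' 2 (-1)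
        ⟨t.coupleJ L₂.obj 2 (-1) y, t.coupleJ_mem_cycles 2 (-1) y⟩)) (add_zero 2)).comp
        (Ext.mk₀ (L₂.iso.hom⟦(-1 : ℤ)⟧')) (add_zero 2)) (zero_add 2) = _
  rw [hdesc, Ext.comp_assoc_of_third_deg_zero, Ext.mk₀_comp_mk₀]
  simp only [Category.assoc]
  rw [h₂, ← Ext.mk₀_comp_mk₀ (F.map v ≫ _), ← Ext.mk₀_comp_mk₀ (S.Q₂.iso.inv ≫ _)]
  have h₄ : t.yonedaClass hF' 2 = ((Ext.mk₀ (𝟙 (F.obj (t.N 0)))).comp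
    (t.shortExact hF' 0).extClass (zero_add 1)).comp (t.shortExact hF' 1).extClass rfl := rfl
  rw [h₄]
  exact comp_comp_eq_of_naturality (N₀ := F.obj (t.N 0)) (N₁ := F.obj (t.N 1))
    (N₂ := F.obj (t.N 2)) (Ω := R.Ω) (P := R.P₂) _ (t.shortExact hF' 0).extClass
    (t.shortExact hF' 1).extClass R.shortExact₀.extClass R.shortExact₁.extClass
    (Ext.mk₀ (F.map t.base.hom ≫ L₁.iso.hom)) (Ext.mk₀ (F.map u₁ ≫ S.D.iso.hom))
    (Ext.mk₀ (F.map v ≫ S.Q₂.iso.hom)) _ _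
    (by rw [Ext.mk₀_comp_mk₀, h₃]) h₀ h₁

end Differential

lemma exists_iso_of_shortExact {𝒜 : Type u₂} [Category.{v₂} 𝒜] [Abelian 𝒜]
    {S S' : ShortComplex 𝒜} (hS : S.ShortExact) (hS' : S'.ShortExact) (β : S.X₂ ≅ S'.X₂)
    (γ : S.X₃ ≅ S'.X₃) (h : S.g ≫ γ.hom = β.hom ≫ S'.g) :
    ∃ α : S.X₁ ≅ S'.X₁, α.hom ≫ S'.f = S.f ≫ β.hom := by
  have := hS.mono_f
  have := hS'.mono_f
  have h₁ : (S.f ≫ β.hom) ≫ S'.g = 0 := by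
    rw [Category.assoc, ← h, S.zero_assoc, zero_comp]
  have h₂ : (S'.f ≫ β.inv) ≫ S.g = 0 := by
    rw [← cancel_mono γ.hom, Category.assoc, Category.assoc, h, Iso.inv_hom_id_assoc, S'.zero,
      zero_comp]
  refine ⟨⟨hS'.exact.lift _ h₁, hS.exact.lift _ h₂, ?_, ?_⟩, hS'.exact.lift_f _ h₁⟩
  · rw [← cancel_mono S.f, Category.assoc, hS.exact.lift_f, ← Category.assoc, hS'.exact.lift_f,
      Category.assoc, Iso.hom_inv_id, Category.comp_id, Category.id_comp]
  · rw [← cancel_mono S'.f, Category.assoc, hS'.exact.lift_f, ← Category.assoc, hS.exact.lift_f,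
      Category.assoc, Iso.inv_hom_id, Category.comp_id, Category.id_comp]

/-! ### Existence of lifted resolutions and cone presentations -/

section Existence

variable {𝒯 : Type u₁} [Category.{v₁} 𝒯] [HasZeroObject 𝒯] [HasShift 𝒯 ℤ] [Preadditive 𝒯]
  [∀ n : ℤ, (shiftFunctor 𝒯 n).Additive] [Pretriangulated 𝒯]
  {𝒜 : Type u₂} [Category.{v₂} 𝒜] [Abelian 𝒜] [HasShift 𝒜 ℤ]
  {I : MorphismProperty 𝒯} {F : 𝒯 ⥤ 𝒜} [F.CommShift ℤ] [F.IsHomological]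

namespace IsFullOnProjectives

variable (hF : IsFullOnProjectives I F)

include hF

omit [HasZeroObject 𝒯] [∀ n : ℤ, (shiftFunctor 𝒯 n).Additive] [Pretriangulated 𝒯]
  [F.IsHomological] in
lemma isContractibleFor_shift {B : 𝒯} (hB : IsContractibleFor I B) (n : ℤ) :
    IsContractibleFor I (B⟦n⟧) := by
  have h₁ : IsZero (F.obj B) := by
    rw [IsZero.iff_id_eq_zero, ← F.map_id]
    exact (hF.map_eq_zero_iff _).1 hB
  have h₂ : IsZero ((F.obj B)⟦n⟧) := by
    rw [IsZero.iff_id_eq_zero, ← (shiftFunctor 𝒜 n).map_id,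
      h₁.eq_of_src (𝟙 (F.obj B)) 0, Functor.map_zero]
  exact (hF.map_eq_zero_iff _).2 ((h₂.of_iso ((F.commShiftIso n).app B)).eq_of_src _ _)

omit [F.IsHomological] in
-- The obstruction to extending a map `X ⟶ B` over `Y` lies in `𝒯(Z, B⟦1⟧)`, which vanishes because
-- shifts of contractible objects are contractible. The extension vanishes as well.
lemma isOrthogonalTo_of_triangle {X Y Z : 𝒯} {f : X ⟶ Y} {g : Y ⟶ Z} {h : Z ⟶ X⟦(1 : ℤ)⟧}
    (hT : Triangle.mk f g h ∈ distTriang 𝒯) (hY : IsOrthogonalTo I Y) (hZ : IsOrthogonalTo I Z) :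
    IsOrthogonalTo I X := fun B hB a => by
  obtain ⟨z, hz⟩ := exists_comp_eq_of_shiftedHom_comp_eq_zero hT (zero_add 1)
    (ShiftedHom.mk₀ (0 : ℤ) rfl a) (hZ _ (hF.isContractibleFor_shift hB 1) _)
  rw [hY _ (hF.isContractibleFor_shift hB 0) z, comp_zero] at hz
  exact (ShiftedHom.homEquiv (0 : ℤ) rfl).injective
    (hz.symm.trans (ShiftedHom.mk₀_zero X B (0 : ℤ) rfl).symm)

/-- An `I`-projective object is the canonical lifting of its image under `F`. -/
def adjointLift {P : 𝒯} (hP : IsProjectiveFor I P) : AdjointLift F (F.obj P) where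
  obj := P
  iso := Iso.refl _
  bijective B := ⟨fun f g h => hF.map_injective hP (by simpa using h), fun a => by
    obtain ⟨f, hf⟩ := hF.map_surjective hP a
    exact ⟨f, by simp [hf]⟩⟩

/-- An object of projective dimension at most two that has a lifting has a projective resolution
of length two that lifts to `𝒯`. -/
lemma exists_liftedResolution [HasCountableCoproducts 𝒯] (hI : HasEnoughProjectives I)
    (hF' : Annihilates I F) {A : 𝒜} (hA : HasProjectiveDimensionLE A 2) (L : Lifting I F A) :
    ∃ R : LengthTwoResolution A, Nonempty (LiftedResolution I F R) := by
  obtain ⟨N, Q₀, φ, π, ι, hQ₀, hT₀, hι⟩ := hF.exists_triangle hI L.obj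
  obtain ⟨N', Q₁, φ', π', ι', hQ₁, hT₁, hι'⟩ := hF.exists_triangle hI N
  have hN : IsOrthogonalTo I N :=
    hF.isOrthogonalTo_of_triangle hT₀ hQ₀.isOrthogonalTo L.orthogonal
  have hN' : IsOrthogonalTo I N' := hF.isOrthogonalTo_of_triangle hT₁ hQ₁.isOrthogonalTo hN
  have hS₀ := shortExact_of_triangle F hT₀ (hF' _ hι)
  have hS₁ := shortExact_of_triangle F hT₁ (hF' _ hι')
  have hP₀ := hF.projective hQ₀
  have hP₁ := hF.projective hQ₁
  -- `F(N')` is a second syzygy of `A`, so the bound on the dimension makes it projective;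
  -- orthogonality of `N'` then makes `N'` itself `I`-projective.
  have hL : HasProjectiveDimensionLT (F.obj L.obj) 3 :=
    (Retract.ofIso L.iso).hasProjectiveDimensionLT 3
  have hdN : HasProjectiveDimensionLT (F.obj N) 2 :=
    hS₀.hasProjectiveDimensionLT_X₁ 2 inferInstance hL
  have hP₂ : Projective (F.obj N') := projective_iff_hasProjectiveDimensionLT_one.2
    (hS₁.hasProjectiveDimensionLT_X₁ 1 inferInstance hdN)
  have hQ₂ : IsProjectiveFor I N' := hF.isProjectiveFor_of_projective hI hN'
  have hπ : Epi (F.map π) := hS₀.epi_g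
  have hπ' : Epi (F.map π') := hS₁.epi_g
  have hφ : Mono (F.map φ) := hS₀.mono_f
  have h₂ : F.map φ' ≫ F.map π' ≫ F.map φ = 0 := by
    rw [reassoc_of% (map_comp_eq_zero F hT₁), zero_comp]
  let R : LengthTwoResolution A :=
    { P₀ := F.obj Q₀
      P₁ := F.obj Q₁
      P₂ := F.obj N'
      d₀ := F.map π ≫ L.iso.hom
      d₁ := F.map π' ≫ F.map φ
      d₂ := F.map φ'
      d₁_d₀ := by
        rw [Category.assoc, reassoc_of% (map_comp_eq_zero F hT₀), zero_comp, comp_zero]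
      d₂_d₁ := h₂
      projective₀ := hP₀
      projective₁ := hP₁
      projective₂ := hP₂
      epi₀ := inferInstance
      exact₀ := by
        rw [ShortComplex.exact_iff_of_epi_of_isIso_of_mono
          (S₁ := ShortComplex.mk _ _ _)
          (S₂ := ShortComplex.mk (F.map φ) (F.map π) (map_comp_eq_zero F hT₀))
          { τ₁ := F.map π', τ₂ := 𝟙 _, τ₃ := L.iso.inv }]
        exact hS₀.exact
      exact₁ := by
        rw [← ShortComplex.exact_iff_of_epi_of_isIso_of_mono
          (S₁ := ShortComplex.mk (F.map φ') (F.map π') (map_comp_eq_zero F hT₁))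
          (S₂ := ShortComplex.mk _ _ h₂)
          { τ₁ := 𝟙 _, τ₂ := 𝟙 _, τ₃ := F.map φ }]
        exact hS₁.exact
      mono₂ := hS₁.mono_f }
  obtain ⟨a, ha⟩ := exists_iso_of_shortExact hS₀ R.shortExact₀ (Iso.refl _) L.iso
    (Category.id_comp _).symm
  change F.obj N ≅ R.Ω at a
  replace ha : a.hom ≫ kernel.ι R.d₀ = F.map φ := ha.trans (Category.comp_id _)
  have ha' : F.map π' ≫ a.hom = R.toΩ := by
    rw [← cancel_mono (kernel.ι R.d₀), kernel.lift_ι, Category.assoc, ha]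
  exact ⟨R, ⟨{
    Q₀ := hF.adjointLift hQ₀
    Q₁ := hF.adjointLift hQ₁
    Q₂ := hF.adjointLift hQ₂
    D := ⟨N, hN, a⟩
    d₂ := φ'
    π₁ := π'
    ι₁ := ι'
    distinguished := hT₁
    map_d₂ := (Category.comp_id _).trans (Category.id_comp _).symm
    map_π₁ := ha'.trans (Category.id_comp _).symm }⟩⟩

/-- Every lifting of `A` is the cone of a lift of `ΩA ⟶ P₀`. -/
lemma nonempty_conePresentation (hF' : Annihilates I F) {A : 𝒜} {R : LengthTwoResolution A}
    (S : LiftedResolution I F R) (L : Lifting I F A) : Nonempty (ConePresentation S L) := by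
  obtain ⟨π, hπ⟩ := (S.Q₀.bijective L.obj).2 (R.d₀ ≫ L.iso.inv)
  dsimp only at hπ
  replace hπ : F.map π ≫ L.iso.hom = S.Q₀.iso.hom ≫ R.d₀ := by
    rw [← cancel_epi S.Q₀.iso.inv, reassoc_of% hπ, Iso.inv_hom_id, Iso.inv_hom_id_assoc,
      Category.comp_id]
  have := R.epi₀
  have : Epi (F.map π) := by
    rw [show F.map π = (S.Q₀.iso.hom ≫ R.d₀) ≫ L.iso.inv by
      rw [← hπ, Category.assoc, Iso.hom_inv_id, Category.comp_id]]
    infer_instance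
  -- The fibre of `π` is a second lifting of `ΩA`, which has to be identified with the given `S.D`.
  obtain ⟨D, φ, θ, hT⟩ := distinguished_cocone_triangle₁ π
  have hS := shortExact_of_triangle F hT (hF' _ (hF.mor₃_mem hT))
  obtain ⟨α, hα⟩ := exists_iso_of_shortExact hS R.shortExact₀ S.Q₀.iso L.iso hπ
  dsimp only at α hα
  -- The adjunction only produces maps out of the `Qⱼ`. A map from `Q₁` inducing the identification
  -- on `F` vanishes on `Q₂` by faithfulness, so it descends to `g` on the cone `S.D`. Since `F(g)`
  -- is invertible and both objects are orthogonal to contractible ones, `g` is invertible.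
  obtain ⟨b, hb⟩ := (S.Q₁.bijective D).2 (S.Q₁.iso.inv ≫ F.map S.π₁ ≫ S.D.iso.hom ≫ α.inv)
  dsimp only at hb
  rw [cancel_epi] at hb
  have hb' : S.d₂ ≫ b = 0 := (S.Q₂.bijective D).1 (by
    dsimp only
    rw [F.map_comp, hb, reassoc_of% (map_comp_eq_zero F S.distinguished), zero_comp, F.map_zero])
  obtain ⟨g, rfl⟩ : ∃ g : S.D.obj ⟶ D, b = S.π₁ ≫ g :=
    Triangle.yoneda_exact₂ _ S.distinguished b hb'
  have := S.epi_map_π₁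
  have hg : F.map g = S.D.iso.hom ≫ α.inv := by rwa [F.map_comp, cancel_epi] at hb
  have : IsIso (F.map g) := by rw [hg]; infer_instance
  have hD : IsOrthogonalTo I D := hF.isOrthogonalTo_of_triangle hT
    (S.Q₀.isProjectiveFor hF').isOrthogonalTo L.orthogonal
  have := hF.isIso_of_isIso_map S.D.orthogonal hD g
  obtain ⟨e, rfl⟩ : ∃ e : S.D.obj ≅ D, e.hom = g := ⟨asIso g, rfl⟩
  exact ⟨{
    φ := e.hom ≫ φ
    π := π
    θ := θ ≫ e.inv⟦(1 : ℤ)⟧'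
    distinguished := isomorphic_distinguished _ hT _
      (Triangle.isoMk _ _ e (Iso.refl _) (Iso.refl _)
        (Category.comp_id _)
        ((Category.comp_id _).trans (Category.id_comp _).symm) (by
          refine Eq.trans ?_ (Category.id_comp _).symm
          change (θ ≫ e.inv⟦(1 : ℤ)⟧') ≫ e.hom⟦(1 : ℤ)⟧' = θ
          rw [Category.assoc, ← (shiftFunctor 𝒯 (1 : ℤ)).map_comp, e.inv_hom_id,
            (shiftFunctor 𝒯 (1 : ℤ)).map_id, Category.comp_id]))
    map_φ := by
      rw [F.map_comp, hg, Category.assoc, Category.assoc, ← hα, Iso.inv_hom_id_assoc]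
    map_π := hπ }⟩

end IsFullOnProjectives

namespace LiftedResolution

variable [HasExt.{w} 𝒜] {A : 𝒜}
  {R : LengthTwoResolution A} (S : LiftedResolution I F R)

lemma obstructionClass_neg (f : S.D.obj ⟶ S.Q₀.obj) (hf : F.map f = 0)
    (hf' : F.map (-f) = 0) : S.obstructionClass.{w} (-f) hf' = -S.obstructionClass f hf := by
  obtain ⟨σ, hσ⟩ := S.exists_factor f hf
  have hσ' : S.ι₁.comp (-σ) (neg_add_cancel 1) = ShiftedHom.mk₀ (0 : ℤ) rfl (-f) := by
    rw [ShiftedHom.comp_neg, hσ, ShiftedHom.mk₀, ShiftedHom.mk₀, Preadditive.neg_comp]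
  have h : ShiftedHom.map (-σ) F = -ShiftedHom.map σ F := by
    rw [ShiftedHom.map, ShiftedHom.map, F.map_neg, Preadditive.neg_comp]
  rw [obstructionClass, obstructionClass, S.uctClass_eq f hf σ hσ, S.uctClass_eq (-f) hf' (-σ) hσ',
    h, Preadditive.comp_neg, Ext.mk₀_neg, Ext.comp_neg, Ext.neg_comp, Ext.comp_neg]

end LiftedResolution

end Existence

end

end HomologicalIdeals

/-! ### The main theorem -/

open HomologicalIdeals in
theorem mainTheorem12
    -- a triangulated category with countable direct sums
    {𝒯 : Type u₁} [Category.{v₁} 𝒯] [HasZeroObject 𝒯] [HasShift 𝒯 ℤ] [Preadditive 𝒯]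
    [∀ n : ℤ, (shiftFunctor 𝒯 n).Additive] [Pretriangulated 𝒯] [IsTriangulated 𝒯]
    [HasCountableCoproducts 𝒯]
    -- a stable abelian category
    {𝒜 : Type u₂} [Category.{v₂} 𝒜] [Abelian 𝒜] [HasShift 𝒜 ℤ]
    [∀ n : ℤ, (shiftFunctor 𝒜 n).Additive] [HasExt.{w} 𝒜]
    -- a stable homological ideal
    (I : MorphismProperty 𝒯)
    (hI : IsStableHomologicalIdeal.{v₁, u₁, max u₁ u₂ v₁ v₂, (max u₁ u₂ v₁ v₂) + 1} I)
    (hI_sums : CompatibleWithCountableSums I) (hI_proj : HasEnoughProjectives I)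
    -- the universal exact stable homological functor
    (F : 𝒯 ⥤ 𝒜) [F.CommShift ℤ] [F.IsHomological]
    (hF : IsUniversalExact.{v₁, v₂, u₁, u₂, max u₁ u₂ v₁ v₂, (max u₁ u₂ v₁ v₂) + 1} I F)
    -- two liftings of an object of cohomological dimension two
    (A : 𝒜) (hA : HasProjectiveDimensionLE A 2) (L₁ L₂ : Lifting I F A) :
    ∃ δ₁₂ δ₂₁ : Ext.{w} A (A⟦(-1 : ℤ)⟧) 2,
      -- these are the well-defined relative obstruction classes
      (∀ c, IsRelativeObstructionClass L₁ L₂ c ↔ c = δ₁₂) ∧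
      (∀ c, IsRelativeObstructionClass L₂ L₁ c ↔ c = δ₂₁) ∧
      δ₁₂ = -δ₂₁ ∧
      -- the differential of the ABC spectral sequence, for any phantom tower of the first lifting
      Nonempty (PhantomTower I L₁.obj) ∧
      ∀ t : PhantomTower I L₁.obj,
        Function.Bijective (e₂ToExt.{w} hF.annihilates L₁ L₂ t 0 0) ∧
        Function.Bijective (e₂ToExt.{w} hF.annihilates L₁ L₂ t 2 (-1)) ∧
        ∀ x : t.E₂ L₂.obj 0 0,
          e₂ToExt.{w} hF.annihilates L₁ L₂ t 0 0 x =
            Ext.mk₀ ((shiftFunctorZero 𝒜 ℤ).inv.app A) →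
          e₂ToExt.{w} hF.annihilates L₁ L₂ t 2 (-1) (t.d₂ 0 (neg_add_cancel 1) x) = δ₁₂ := by
  have hF₀ := hF.isFullOnProjectives hI
  have hF' := hF.annihilates
  obtain ⟨R, ⟨S⟩⟩ := hF₀.exists_liftedResolution hI_proj hF' hA L₁
  obtain ⟨C₁⟩ := hF₀.nonempty_conePresentation hF' S L₁
  obtain ⟨C₂⟩ := hF₀.nonempty_conePresentation hF' S L₂
  -- Both classes equal the second differential of the identity in one fixed tower, where neither
  -- resolution appears.
  have unique : ∀ (L L' : Lifting I F A) (c c' : Ext.{w} A (A⟦(-1 : ℤ)⟧) 2),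
      IsRelativeObstructionClass L L' c → IsRelativeObstructionClass L L' c' → c = c' := by
    rintro L L' _ _ ⟨R, S, C, C', rfl⟩ ⟨R', S', D, D', rfl⟩
    obtain ⟨t⟩ := hF₀.nonempty_phantomTower hI_proj L.obj
    obtain ⟨x, hx⟩ := (e₂ToExt_bijective hF₀ hF' L L' t 0 0).2
      (Ext.mk₀ ((shiftFunctorZero 𝒜 ℤ).inv.app A))
    rw [← e₂ToExt_d₂_eq_obstructionClass hF₀ hF' t S C C' x hx,
      e₂ToExt_d₂_eq_obstructionClass hF₀ hF' t S' D D' x hx]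
  refine ⟨S.obstructionClass (C₁.φ - C₂.φ) (S.map_sub_eq_zero C₁ C₂),
    S.obstructionClass (C₂.φ - C₁.φ) (S.map_sub_eq_zero C₂ C₁),
    fun c => ⟨fun hc => unique _ _ _ _ hc ⟨R, S, C₁, C₂, rfl⟩, ?_⟩,
    fun c => ⟨fun hc => unique _ _ _ _ hc ⟨R, S, C₂, C₁, rfl⟩, ?_⟩, ?_,
    hF₀.nonempty_phantomTower hI_proj L₁.obj, fun t =>
    ⟨e₂ToExt_bijective hF₀ hF' L₁ L₂ t 0 0, e₂ToExt_bijective hF₀ hF' L₁ L₂ t 2 (-1),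
      fun x hx => e₂ToExt_d₂_eq_obstructionClass hF₀ hF' t S C₁ C₂ x hx⟩⟩
  · rintro rfl
    exact ⟨R, S, C₁, C₂, rfl⟩
  · rintro rfl
    exact ⟨R, S, C₂, C₁, rfl⟩
  · have h := S.obstructionClass_neg (C₂.φ - C₁.φ) (S.map_sub_eq_zero C₂ C₁)
      (by rw [neg_sub]; exact S.map_sub_eq_zero C₁ C₂)
    simp only [neg_sub] at h
    exact h
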